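/- **Setting.** Let $N,M\ge 1$ be integers. Let $\mathbf w=(w_1,\dots,w_M)$ and $\mathbf y=(y_1,y_2,\dots)$ be complex numbers, and let $\boldsymbol\theta=(\theta_1,\dots,\theta_M)$ and $\mathbf s=(s_1,s_2,\dots)$ be nonzero complex numbers. A signature with $N$ parts is an integer sequence $\nu=(\nu_1\ge\dots\ge\nu_N\ge 0)$. Put $\mathcal S(\nu)=\{\nu_1+N,\nu_2+N-1,\dots,\nu_N+1\}$. *The functions $G$.* For signatures $\lambda,\nu$ with $N$ parts, $G_{\nu/\lambda}(\mathbf w;\mathbf y;\boldsymbol\theta;\mathbf s)$ is the partition function (sum over configurations of the product of vertex weights) of the six vertex model in the half-infinite strip $\mathbb Z_{\ge1}\times\{1,\dots,M\}$. Paths enter from the bottom at the columns in $\mathcal S(\lambda)$ and exit at the top at the columns in $\mathcal S(\nu)$. The left boundary and the boundary far to the right are empty. The weight of the vertex $(i,j)$ is $W(i_1,j_1;i_2,j_2\mid w_j;y_i;\theta_j;s_i)$, where $i_1,j_1,i_2,j_2\in\{0,1\}$ are the states of its bottom, left, top and right edges and $$W(0,0;0,0)=1,\quad W(1,1;1,1)=\frac{r^{-2}x-y}{s^{-2}y-x},\quad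 W(1,0;1,0)=\frac{s^{-2}y-r^{-2}x}{s^{-2}y-x},$$ $$W(0,1;0,1)=\frac{y-x}{s^{-2}y-x},\quad W(1,0;0,1)=\frac{x(r^{-2}-1)}{s^{-2}y-x},\quad W(0,1;1,0)=\frac{y(s^{-2}-1)}{s^{-2}y-x}$$ for $W=W(\,\cdot\mid x;y;r;s)$; all other weights are $0$, and in a configuration $i_1+j_1=i_2+j_2$ at every vertex. Put $G_\nu=G_{\nu/(0,\dots,0)}$. *The integrals.* Throughout, $\frac1{2\pi\mathbf i}\oint_{\gamma'}$ has one of the following two meanings, and the results hold for both. 1. It is the integral over a closed piecewise $C^1$ contour $\gamma'$ that avoids all the points below, has winding number $1$ about every $y_j$ ($j\ge1$) and every $w_i$, and has winding number $0$ about every $s_j^{-2}y_j$ ($j\ge1$). It is assumed that such a contour exists. 2. It is the formal integral, that is, the sum of the residues of the integrand at all the points of the set $\{y_j\}_{j\ge1}\cup\{w_i\}_{1\le i\le M}$. It is assumed that this set is disjoint from $\{s_j^{-2}y_j\}_{j\ge1}$. *Single-variable functions.* For $k\ge0$ and $p\ge1$ let $$\psi_k(z\mid\mathbf y;\mathbf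 s)=\frac{y_{k+1}(s_{k+1}^2-1)}{y_{k+1}-s_{k+1}^2z}\prod_{j=1}^{k}\frac{s_j^2(y_j-z)}{y_j-s_j^2z},$$ $$\mathsf h_{k,p}(\mathbf w;\mathbf y;\boldsymbol\theta;\mathbf s)=\frac1{2\pi\mathbf i}\oint_{\gamma'}\frac{\psi_k(z\mid\mathbf y;\mathbf s)}{y_p-z}\prod_{j=1}^M\frac{z-\theta_j^{-2}w_j}{z-w_j}\,dz .$$ For $l\in\mathbb Z$ let $\widetilde{\mathsf h}_l=0$ if $l<0$, and for $l\ge0$ let $$\widetilde{\mathsf h}_l(\mathbf w;\mathbf y;\boldsymbol\theta;\mathbf s)=\frac1{2\pi\mathbf i}\oint_{\gamma'}\frac{(s_{l+1}^2-1)\,y_{l+1}}{(y_{l+1}-s_{l+1}^2z)(y_1-z)}\prod_{j=1}^{l}\frac{s_j^2(y_j-z)}{y_j-s_j^2z}\prod_{j=1}^M\frac{z-\theta_j^{-2}w_j}{z-w_j}\,dz .$$ For $l,k\ge0$ put $\mathsf g_{l/k}(\mathbf w;\mathbf y;\boldsymbol\theta;\mathbf s)=\widetilde{\mathsf h}_{l-k}(\mathbf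 w;\mathrm{sh}_k\mathbf y;\boldsymbol\theta;\mathrm{sh}_k\mathbf s)$, where $(\mathrm{sh}_k\mathbf y)_i=y_{k+i}$ and $(\mathrm{sh}_k\mathbf s)_i=s_{k+i}$. The integral in $\mathsf g_{l/k}$ is taken over the same $\gamma'$ (or, formally, at the same points), defined by the unshifted sequences. **Proposition.** (i) If $y_1,\dots,y_N$ are pairwise distinct, then for every signature $\nu$ with $N$ parts $$G_\nu(\mathbf w;\mathbf y;\boldsymbol\theta;\mathbf s)=\prod_{1\le i<j\le N}\frac{s_i^{-2}y_i-y_j}{y_j-y_i}\;\det\bigl[\mathsf h_{\nu_i+N-i,\,j}(\mathbf w;\mathbf y;\boldsymbol\theta;\mathbf s)\bigr]_{i,j=1}^N .$$ (ii) For all signatures $\lambda,\nu$ with $N$ parts $$G_{\nu/\lambda}(\mathbf w;\mathbf y;\boldsymbol\theta;\mathbf s)=\det\bigl[\mathsf g_{(\nu_i+N-i)/(\lambda_j+N-j)}(\mathbf w;\mathbf y;\boldsymbol\theta;\mathbf s)\bigr]_{i,j=1}^N .$$ -/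

import Mathlib

open scoped Topology Real

noncomputable section

/-!
Conventions. Everything is indexed from zero: a sequence `y : ℕ → ℂ` stores `y₁, y₂, …` as
`y 0, y 1, …`, and the lattice column with coordinate `i + 1` is represented by `i : ℕ`.
A (nonnegative) signature with `N` parts is an antitone function `Fin N → ℕ`.
-/

namespace FreeFermion

/-! ### The six vertex model and the functions `G` -/

/-- The free fermion six vertex weight `W(i₁, j₁; i₂, j₂ | x; y; r; s)`, where `i₁`, `j₁`, `i₂`, `j₂`
are the states of the bottom, left, top and right edge of the vertex. -/
def vertexWeight (x y r s : ℂ) : Bool → Bool → Bool → Bool → ℂ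
  | false, false, false, false => 1
  | true, true, true, true => ((r ^ 2)⁻¹ * x - y) / ((s ^ 2)⁻¹ * y - x)
  | true, false, true, false => ((s ^ 2)⁻¹ * y - (r ^ 2)⁻¹ * x) / ((s ^ 2)⁻¹ * y - x)
  | false, true, false, true => (y - x) / ((s ^ 2)⁻¹ * y - x)
  | true, false, false, true => x * ((r ^ 2)⁻¹ - 1) / ((s ^ 2)⁻¹ * y - x)
  | false, true, true, false => y * ((s ^ 2)⁻¹ - 1) / ((s ^ 2)⁻¹ * y - x)
  | _, _, _, _ => 0

/-- The site of the `i`-th particle of a signature with `N` parts. With indices from one it is the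
exponent `ν_i + N - i`; the lattice column is this number plus one. -/
def site {N : ℕ} (ν : Fin N → ℕ) (i : Fin N) : ℕ := ν i + (N - 1 - (i : ℕ))

/-- The set of occupied columns `S(ν) = {ν₁ + N, ν₂ + N - 1, …, ν_N + 1}`, shifted by one. -/
def occupied {N : ℕ} (ν : Fin N → ℕ) : Set ℕ := Set.range (site ν)

/-- Six vertex path configurations in the half-infinite strip with `M` rows: paths enter from the
bottom at the columns in `S`, exit at the top at the columns in `T`, and the left boundary and the
boundary far to the right are empty.
`vert i j` is the state of the vertical edge of column `i` that lies below row `j` (above the top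
row for `j = M`); `horiz i j` is the state of the horizontal edge of row `j` that enters
column `i` from the left. -/
structure PathConfig (M : ℕ) (S T : Set ℕ) where
  vert : ℕ → Fin (M + 1) → Bool
  horiz : ℕ → Fin M → Bool
  /-- path preservation `i₁ + j₁ = i₂ + j₂` at every vertex -/
  preserve : ∀ (i : ℕ) (j : Fin M),
    (vert i j.castSucc).toNat + (horiz i j).toNat =
      (vert i j.succ).toNat + (horiz (i + 1) j).toNat
  bottom : ∀ i, vert i 0 = true ↔ i ∈ S
  top : ∀ i, vert i (Fin.last M) = true ↔ i ∈ T
  left : ∀ j, horiz 0 j = false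
  right : ∀ j, ∃ L, ∀ i, L ≤ i → horiz i j = false

/-- The weight of a configuration: the product of the vertex weights over the half-infinite strip
(all but finitely many vertices are empty and have weight one). The parameters `(x_j, r_j)` are
attached to row `j` and `(y_i, s_i)` to column `i`. -/
def PathConfig.weight {M : ℕ} {S T : Set ℕ} (c : PathConfig M S T)
    (x : Fin M → ℂ) (y : ℕ → ℂ) (r : Fin M → ℂ) (s : ℕ → ℂ) : ℂ :=
  ∏ j : Fin M, ∏ᶠ i : ℕ, vertexWeight (x j) (y i) (r j) (s i)
    (c.vert i j.castSucc) (c.horiz i j) (c.vert i j.succ) (c.horiz (i + 1) j)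

/-- The partition function `G_{ν/μ}(x; y; r; s)`: the sum of the weights of all (finitely many)
configurations with bottom boundary `S(μ)` and top boundary `S(ν)`. -/
def skewG {N M : ℕ} (ν μ : Fin N → ℕ) (x : Fin M → ℂ) (y : ℕ → ℂ) (r : Fin M → ℂ) (s : ℕ → ℂ) : ℂ :=
  ∑ᶠ c : PathConfig M (occupied μ) (occupied ν), c.weight x y r s

/-- `G_ν = G_{ν/(0,…,0)}`. -/
def nonskewG {N M : ℕ} (ν : Fin N → ℕ) (x : Fin M → ℂ) (y : ℕ → ℂ) (r : Fin M → ℂ) (s : ℕ → ℂ) : ℂ :=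
  skewG ν (fun _ => 0) x y r s

/-! ### Contours and formal integrals -/

/-- A closed piecewise continuously differentiable curve, parametrized by `[0, 1]`. -/
def IsClosedContour (γ : ℝ → ℂ) : Prop :=
  γ 0 = γ 1 ∧ ∃ (n : ℕ) (t : ℕ → ℝ), Monotone t ∧ t 0 = 0 ∧ t n = 1 ∧
    ∀ i < n, ContDiffOn ℝ 1 γ (Set.Icc (t i) (t (i + 1)))

/-- The normalized contour integral `(2πi)⁻¹ ∮_γ f(z) dz`. -/
def contourIntegral (γ : ℝ → ℂ) (f : ℂ → ℂ) : ℂ :=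
  (2 * π * Complex.I)⁻¹ * ∫ t in (0 : ℝ)..1, f (γ t) * deriv γ t

/-- `γ` avoids the point `p` and has winding number `m` about it. -/
def HasWinding (γ : ℝ → ℂ) (p : ℂ) (m : ℤ) : Prop :=
  (∀ t ∈ Set.Icc (0 : ℝ) 1, γ t ≠ p) ∧ contourIntegral γ (fun z => (z - p)⁻¹) = m

/-- `γ` is a contour `γ'`: it goes once, in the positive direction, around all the `y_j` and `w_i`,
and leaves out all the `s_j⁻² y_j`. -/
def IsSeparatingContour {M : ℕ} (γ : ℝ → ℂ) (w : Fin M → ℂ) (y s : ℕ → ℂ) : Prop :=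
  IsClosedContour γ ∧ (∀ j, HasWinding γ (y j) 1) ∧ (∀ i, HasWinding γ (w i) 1) ∧
    ∀ j, HasWinding γ ((s j ^ 2)⁻¹ * y j) 0

/-- The residue of `f` at the (possibly removable) isolated singularity `p`: the common value of
`(2πi)⁻¹ ∮ f(z) dz` over small positively oriented circles about `p`. -/
def residue (f : ℂ → ℂ) (p : ℂ) : ℂ :=
  Filter.limUnder (𝓝[>] (0 : ℝ)) fun ρ => (2 * π * Complex.I)⁻¹ * ∮ z in C(p, ρ), f z

/-- The formal integral: the sum of the residues at the points of the set `P`. -/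
def formalIntegral (P : Set ℂ) (f : ℂ → ℂ) : ℂ := ∑ᶠ p ∈ P, residue f p

/-- The functional `J` is `f ↦ (2πi)⁻¹ ∮_{γ'} f(z) dz`, in one of its two senses: the integral over
some contour `γ'` as above, or, provided that none of the points `y_j`, `w_i` is one of the points
`s_k⁻² y_k`, the formal integral, that is, the sum of the residues at all `y_j` and `w_i`. -/
def IsIntegralAround {M : ℕ} (w : Fin M → ℂ) (y s : ℕ → ℂ) (J : (ℂ → ℂ) → ℂ) : Prop :=
  (∃ γ : ℝ → ℂ, IsSeparatingContour γ w y s ∧ J = contourIntegral γ) ∨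
    (Disjoint (Set.range y ∪ Set.range w) (Set.range fun k => (s k ^ 2)⁻¹ * y k) ∧
      J = formalIntegral (Set.range y ∪ Set.range w))

/-! ### Single-variable functions; `J` stands for `(2πi)⁻¹ ∮_{γ'}` -/

/-- `ψ_k(z | y; s)`. -/
def psi (k : ℕ) (z : ℂ) (y s : ℕ → ℂ) : ℂ :=
  y k * (s k ^ 2 - 1) / (y k - s k ^ 2 * z) *
    ∏ j ∈ Finset.range k, s j ^ 2 * (y j - z) / (y j - s j ^ 2 * z)

/-- `h_{k,p}(w; y; θ; s)`; the index `p` is counted from zero. -/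
def h (J : (ℂ → ℂ) → ℂ) {M : ℕ} (k p : ℕ) (w : Fin M → ℂ) (y : ℕ → ℂ) (θ : Fin M → ℂ) (s : ℕ → ℂ) :
    ℂ :=
  J fun z => psi k z y s / (y p - z) * ∏ j : Fin M, (z - (θ j ^ 2)⁻¹ * w j) / (z - w j)

/-- `h̃_l(w; y; θ; s)`, for all integers `l`; it is zero for `l < 0`. -/
def hTilde (J : (ℂ → ℂ) → ℂ) {M : ℕ} (l : ℤ) (w : Fin M → ℂ) (y : ℕ → ℂ) (θ : Fin M → ℂ)
    (s : ℕ → ℂ) : ℂ :=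
  if 0 ≤ l then
    J fun z =>
      (s l.toNat ^ 2 - 1) * y l.toNat / ((y l.toNat - s l.toNat ^ 2 * z) * (y 0 - z)) *
        (∏ j ∈ Finset.range l.toNat, s j ^ 2 * (y j - z) / (y j - s j ^ 2 * z)) *
        ∏ j : Fin M, (z - (θ j ^ 2)⁻¹ * w j) / (z - w j)
  else 0

/-- The shift `sh_m` of a sequence. -/
def shift (m : ℕ) (y : ℕ → ℂ) : ℕ → ℂ := fun i => y (m + i)

/-- `g_{l/k}(w; y; θ; s) = h̃_{l-k}(w; sh_k y; θ; sh_k s)`. -/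
def g (J : (ℂ → ℂ) → ℂ) {M : ℕ} (l k : ℕ) (w : Fin M → ℂ) (y : ℕ → ℂ) (θ : Fin M → ℂ) (s : ℕ → ℂ) :
    ℂ :=
  hTilde J ((l : ℤ) - (k : ℤ)) w (shift k y) θ (shift k s)

end FreeFermion

end

/-! The weights satisfy the free fermion condition (`vertexWeight_free_fermion`), so paths behave
like noninteracting fermions. Assign to each column a vector and to a set of occupied columns the
ordered wedge product of its vectors. Then the row transfer matrix applies a linear one-particle map
to each factor (`sum_rowAmp_smul_ordProd`). Composing the `M` rows and taking the top-degree
coefficient gives a Slater determinant of one-particle amplitudes (`skewG_eq_det`), which start as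
Kronecker deltas at the columns of `lam` and evolve by `rowEvolve`.

It remains to show that these amplitudes are integrals of `psi l`, `phi k` and one factor `(z - θ⁻²
w) / (z - w)` per row. With no rows this is the biorthogonality of `psi` and `phi`
(`integral_psi_mul_phi`). Adding a row works because `psi` is an eigenfunction of the one-row
evolution up to a term in `(z - w)⁻¹` (`rowEvolve_psi`). In the integrand this term has all its
poles inside the contour and decays like `z⁻²`, so it integrates to zero (`amplitude_insert`).

Both meanings of the integral enter only through the properties in `IsResidueFunctional`. They yield
two vanishing rules: the integral is zero if all poles are inside and the decay is at least
quadratic, or if all poles are outside and the function vanishes at infinity.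

Cancelling common factors of `psi` and `phi` turns the amplitudes into `g`, which gives (ii). For
(i) the initial columns are the first `N`. Partial fractions write `phi k` as a combination of the
`(y p - z)⁻¹` with `p ≤ k`, a triangular change of columns whose diagonal entries produce the
prefactor; the sign of the column reversal turns `y i - y j` into `y j - y i`. -/

noncomputable section

namespace FreeFermion

/-! ### Row transfer in the exterior algebra -/

section Row

/-- The sum over the horizontal states of the product of the weights of the first `n` vertices of a
row with bottom state `σ` and top state `τ`, where the edge leaving the `n`-th vertex to the right
is in a given state. -/
def rowAmp (x : ℂ) (y : ℕ → ℂ) (r : ℂ) (s : ℕ → ℂ) (σ τ : Finset ℕ) : ℕ → Bool → ℂ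
  | 0, h' => if h' then 0 else 1
  | n + 1, h' =>
      rowAmp x y r s σ τ n false *
          vertexWeight x (y n) r (s n) (decide (n ∈ σ)) false (decide (n ∈ τ)) h' +
        rowAmp x y r s σ τ n true *
          vertexWeight x (y n) r (s n) (decide (n ∈ σ)) true (decide (n ∈ τ)) h'

/-- The ordered product of the `X i` over `i < n` in `σ`. -/
def ordProd {A : Type*} [Monoid A] (X : ℕ → A) (σ : Finset ℕ) : ℕ → A
  | 0 => 1
  | n + 1 => ordProd X σ n * (if n ∈ σ then X n else 1)

variable {E : Type*} [AddCommGroup E] [Module ℂ E]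

/-- The one particle amplitudes on the horizontal edges of a row, for the amplitudes `v` on the
vertical edges below the row. -/
def horizVec (x : ℂ) (y : ℕ → ℂ) (r : ℂ) (s : ℕ → ℂ) (v : ℕ → E) : ℕ → E
  | 0 => 0
  | n + 1 => vertexWeight x (y n) r (s n) false true false true • horizVec x y r s v n +
      vertexWeight x (y n) r (s n) true false false true • v n

/-- The one particle amplitudes on the vertical edges above a row, for the amplitudes `v` on the
vertical edges below the row. -/
def rowEvolve (x : ℂ) (y : ℕ → ℂ) (r : ℂ) (s : ℕ → ℂ) (v : ℕ → E) (n : ℕ) : E :=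
  vertexWeight x (y n) r (s n) false true true false • horizVec x y r s v n +
    vertexWeight x (y n) r (s n) true false true false • v n

/-- This identity is what makes the model free: the doubly occupied vertex is a 2 by 2 minor of
one-particle weights, so it can be read off from the wedge product of two one-particle states. -/
theorem vertexWeight_free_fermion (x y r s : ℂ) (hx : (s ^ 2)⁻¹ * y - x ≠ 0) :
    vertexWeight x y r s true true true true =
      vertexWeight x y r s false true true false * vertexWeight x y r s true false false true -
      vertexWeight x y r s true false true false * vertexWeight x y r s false true false true := by
  simp only [vertexWeight]
  rw [div_mul_div_comm, div_mul_div_comm, ← sub_div, div_eq_div_iff hx (mul_ne_zero hx hx)]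
  ring

theorem rowAmp_congr (x : ℂ) (y : ℕ → ℂ) (r : ℂ) (s : ℕ → ℂ) {σ σ' : Finset ℕ} (τ : Finset ℕ)
    (n : ℕ) (hσ : ∀ i < n, i ∈ σ ↔ i ∈ σ') (h' : Bool) :
    rowAmp x y r s σ τ n h' = rowAmp x y r s σ' τ n h' := by
  induction n generalizing h' with
  | zero => rfl
  | succ n ih =>
    have := ih fun i hi => hσ i (by omega)
    have hn := hσ n (by omega)
    simp only [rowAmp, this, hn]

theorem ordProd_congr {A : Type*} [Monoid A] (X : ℕ → A) {σ σ' : Finset ℕ} (n : ℕ)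
    (hσ : ∀ i < n, i ∈ σ ↔ i ∈ σ') : ordProd X σ n = ordProd X σ' n := by
  induction n with
  | zero => rfl
  | succ n ih =>
    have := ih fun i hi => hσ i (by omega)
    have hn := hσ n (by omega)
    simp only [ordProd, this, hn]

/-- Induction on the columns, carrying the horizontal edge as one extra wedge factor on the right.
The four cases of top and right states compare the two sides vertex by vertex; only the case where
both are occupied is quadratic, and there anticommutation together with the free fermion identity
closes the step. -/
theorem sum_rowAmp_smul_ordProd (x : ℂ) (y : ℕ → ℂ) (r : ℂ) (s : ℕ → ℂ)
    (hx : ∀ i, (s i ^ 2)⁻¹ * y i - x ≠ 0) (v : ℕ → E) (τ : Finset ℕ) (n : ℕ) (h' : Bool) :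
    ∑ σ ∈ (Finset.range n).powerset,
        rowAmp x y r s σ τ n h' • ordProd (fun i => ExteriorAlgebra.ι ℂ (v i)) σ n =
      ordProd (fun i => ExteriorAlgebra.ι ℂ (rowEvolve x y r s v i)) τ n *
        (if h' then ExteriorAlgebra.ι ℂ (horizVec x y r s v n) else 1) := by
  induction n generalizing h' with
  | zero => cases h' <;> simp [rowAmp, ordProd, horizVec]
  | succ n ih =>
    rw [Finset.range_add_one, Finset.sum_powerset_insert Finset.notMem_range_self]
    have e1 : ∀ σ ∈ (Finset.range n).powerset,
        rowAmp x y r s σ τ (n + 1) h' •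
          ordProd (fun i => ExteriorAlgebra.ι ℂ (v i)) σ (n + 1) =
        vertexWeight x (y n) r (s n) false false (decide (n ∈ τ)) h' •
          (rowAmp x y r s σ τ n false • ordProd (fun i => ExteriorAlgebra.ι ℂ (v i)) σ n) +
        vertexWeight x (y n) r (s n) false true (decide (n ∈ τ)) h' •
          (rowAmp x y r s σ τ n true • ordProd (fun i => ExteriorAlgebra.ι ℂ (v i)) σ n) := by
      intro σ hσ
      have hn : n ∉ σ := fun hm => by simpa using Finset.mem_powerset.1 hσ hm
      simp only [rowAmp, ordProd, hn, decide_false, if_false, mul_one]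
      module
    have e2 : ∀ σ ∈ (Finset.range n).powerset,
        rowAmp x y r s (insert n σ) τ (n + 1) h' •
          ordProd (fun i => ExteriorAlgebra.ι ℂ (v i)) (insert n σ) (n + 1) =
        (vertexWeight x (y n) r (s n) true false (decide (n ∈ τ)) h' •
          (rowAmp x y r s σ τ n false • ordProd (fun i => ExteriorAlgebra.ι ℂ (v i)) σ n) +
        vertexWeight x (y n) r (s n) true true (decide (n ∈ τ)) h' •
          (rowAmp x y r s σ τ n true • ordProd (fun i => ExteriorAlgebra.ι ℂ (v i)) σ n)) *
          ExteriorAlgebra.ι ℂ (v n) := by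
      intro σ hσ
      have hc : ∀ i < n, i ∈ insert n σ ↔ i ∈ σ := fun i hi => by
        simp [Finset.mem_insert, hi.ne]
      simp only [rowAmp, ordProd, Finset.mem_insert_self, decide_true, if_true,
        rowAmp_congr x y r s τ n hc, ordProd_congr (fun i => ExteriorAlgebra.ι ℂ (v i)) n hc, ← smul_mul_assoc, smul_smul, ← add_smul]
      ring_nf
    rw [Finset.sum_congr rfl e1, Finset.sum_congr rfl e2, ← Finset.sum_mul]
    simp only [Finset.sum_add_distrib, ← Finset.smul_sum, ih]
    have hsq : ∀ u : E, ExteriorAlgebra.ι ℂ u * ExteriorAlgebra.ι ℂ u = 0 :=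
      ExteriorAlgebra.ι_sq_zero
    have hanti : ExteriorAlgebra.ι ℂ (v n) * ExteriorAlgebra.ι ℂ (horizVec x y r s v n) =
        - (ExteriorAlgebra.ι ℂ (horizVec x y r s v n) * ExteriorAlgebra.ι ℂ (v n)) :=
      eq_neg_of_add_eq_zero_left (ExteriorAlgebra.ι_add_mul_swap _ _)
    simp only [ordProd, mul_assoc, horizVec]
    generalize ordProd (fun i => ExteriorAlgebra.ι ℂ (rowEvolve x y r s v i)) τ n = Q
    by_cases hn : n ∈ τ
    · cases h'
      · simp [hn, rowEvolve, vertexWeight, mul_add]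
      -- With `h` the horizontal vector and `v` the vertical one, the product of the two outgoing
      -- vectors loses its squares `h h` and `v v`, and `v h = -h v` leaves exactly the minor times
      -- `h v`.
      · simp only [hn, decide_true, if_true, vertexWeight_free_fermion _ _ _ _ (hx n), rowEvolve, map_add,
          map_smul, mul_add, add_mul, smul_mul_smul_comm, hsq, hanti]
        simp [vertexWeight, mul_assoc]
        module
    · cases h'
      · simp [hn, vertexWeight]
      · simp [hn, vertexWeight, mul_add]
end Row

/-! ### Slater determinants -/

section Slater

theorem ordProd_eq_prod_filter {A : Type*} [Monoid A] (X : ℕ → A) (σ : Finset ℕ) (n : ℕ) :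
    ordProd X σ n = (((List.range n).filter (· ∈ σ)).map X).prod := by
  induction n with
  | zero => rfl
  | succ n ih =>
    rw [ordProd, ih, List.range_succ, List.filter_append, List.map_append, List.prod_append]
    by_cases hn : n ∈ σ <;> simp [hn]

theorem ordProd_image {A : Type*} [Monoid A] (X : ℕ → A) {k n : ℕ} {t : Fin k → ℕ}
    (ht : StrictMono t) (hn : ∀ i, t i < n) :
    ordProd X (Finset.univ.image t) n = (List.ofFn fun i => X (t i)).prod := by
  rw [ordProd_eq_prod_filter]
  have : (List.range n).filter (· ∈ Finset.univ.image t) = List.ofFn t := by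
    refine List.Perm.eq_of_sortedLE ?_ ?_ ?_
    · exact ((List.pairwise_le_range).filter _).sortedLE
    · exact ht.monotone.sortedLE_ofFn
    · rw [List.perm_ext_iff_of_nodup (List.nodup_range.filter _) (List.nodup_ofFn.2 ht.injective)]
      intro a
      simp only [List.mem_filter, List.mem_range, List.mem_ofFn, decide_eq_true_eq,
        Finset.mem_image, Finset.mem_univ, true_and]
      constructor
      · exact fun h => h.2
      · rintro ⟨i, rfl⟩
        exact ⟨hn i, i, rfl⟩
  rw [this, List.map_ofFn]
  rfl

/-- The linear form on the exterior algebra of `ℂ ^ N` that is the determinant, with the order of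
the rows reversed, in degree `N` and zero in the other degrees. -/
def topForm (N : ℕ) : ExteriorAlgebra ℂ (Fin N → ℂ) →ₗ[ℂ] ℂ :=
  ExteriorAlgebra.liftAlternating
    (Pi.single (M := fun i => (Fin N → ℂ) [⋀^Fin i]→ₗ[ℂ] ℂ) N
      (Matrix.detRowAlternating.domDomCongr Fin.revPerm))

/-- `ordProd` multiplies in increasing order of columns while `t` decreases; the reversal built into
`topForm` compensates, so no sign appears. -/
theorem topForm_ordProd {N n : ℕ} (v : ℕ → Fin N → ℂ) {t : Fin N → ℕ} (ht : StrictAnti t)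
    (hn : ∀ i, t i < n) :
    topForm N (ordProd (fun l => ExteriorAlgebra.ι ℂ (v l)) (Finset.univ.image t) n) =
      (Matrix.of fun i j => v (t i) j).det := by
  have hmono : StrictMono (t ∘ Fin.rev) := fun i j hij => ht (Fin.rev_lt_rev.2 hij)
  have him : Finset.univ.image t = Finset.univ.image (t ∘ Fin.rev) := by
    ext a
    simp only [Finset.mem_image, Finset.mem_univ, true_and, Function.comp]
    exact (Fin.revPerm.surjective.exists (p := fun i => t i = a))
  rw [him, ordProd_image _ hmono (fun i => hn _)]
  have := ExteriorAlgebra.ιMulti_apply (R := ℂ) (fun i => v ((t ∘ Fin.rev) i))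
  rw [← this, topForm, ExteriorAlgebra.liftAlternating_apply_ιMulti, Pi.single_eq_same,
    AlternatingMap.domDomCongr_apply]
  change Matrix.det _ = _
  congr 1
  ext i j
  simp

theorem topForm_ordProd_of_card_ne {N n : ℕ} (v : ℕ → Fin N → ℂ) {σ : Finset ℕ}
    (hn : ∀ i ∈ σ, i < n) (hσ : σ.card ≠ N) :
    topForm N (ordProd (fun l => ExteriorAlgebra.ι ℂ (v l)) σ n) = 0 := by
  have him := σ.image_orderEmbOfFin_univ rfl
  rw [← him, ordProd_image _ (σ.orderEmbOfFin rfl).strictMono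
    (fun i => hn _ (σ.orderEmbOfFin_mem rfl i))]
  have := ExteriorAlgebra.ιMulti_apply (R := ℂ) (fun i => v (σ.orderEmbOfFin rfl i))
  rw [← this, topForm, ExteriorAlgebra.liftAlternating_apply_ιMulti, Pi.single_eq_of_ne hσ]
  rfl

/-- This is the initial condition below the first row. A set of `N` columns other than the image of
`t` contains a column outside it, whose vector is zero. -/
theorem topForm_ordProd_delta {N n : ℕ} {t : Fin N → ℕ} (ht : StrictAnti t)
    {σ : Finset ℕ} (hn : ∀ i ∈ σ, i < n) :
    topForm N (ordProd (fun l => ExteriorAlgebra.ι ℂ fun j => if l = t j then (1 : ℂ) else 0) σ n) =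
      if σ = Finset.univ.image t then 1 else 0 := by
  split_ifs with h
  · subst h
    rw [topForm_ordProd _ ht (fun i => hn _ (by simp))]
    convert Matrix.det_one (n := Fin N) (R := ℂ)
    ext i j
    simp [Matrix.one_apply, ht.injective.eq_iff]
  · by_cases hc : σ.card = N
    · have hsub : ¬ σ ⊆ Finset.univ.image t := fun hs =>
        h (Finset.eq_of_subset_of_card_le hs
          (by rw [Finset.card_image_of_injective _ ht.injective, hc]; simp))
      obtain ⟨a, ha, hat⟩ := Finset.not_subset.1 hsub
      let f : Fin N → ℕ := fun i => σ.orderEmbOfFin hc i.rev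
      have hf : StrictAnti f := fun i j hij =>
        (σ.orderEmbOfFin hc).strictMono (Fin.rev_lt_rev.2 hij)
      have hfσ : Finset.univ.image f = σ := by
        refine Finset.eq_of_subset_of_card_le ?_ ?_
        · intro b hb
          obtain ⟨i, -, rfl⟩ := Finset.mem_image.1 hb
          exact σ.orderEmbOfFin_mem hc _
        · rw [Finset.card_image_of_injective _ hf.injective, hc]; simp
      have hf' : ∀ i, f i ∈ σ := fun i => σ.orderEmbOfFin_mem hc _
      rw [← hfσ] at ha ⊢
      obtain ⟨i, -, rfl⟩ := Finset.mem_image.1 ha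
      rw [topForm_ordProd _ hf (fun i => hn _ (hf' i))]
      refine Matrix.det_eq_zero_of_row_eq_zero i fun j => ?_
      have : f i ≠ t j := fun hij => hat (by simp [hij])
      simp [this]
    · exact topForm_ordProd_of_card_ne _ hn hc

end Slater

/-! ### Sums over chains of states -/

/-- Here `Ψ` is a family of row vectors carried along by the transfer matrices `K`; the sum over the
first state absorbs one matrix at a time. -/
theorem sum_chain {α : Type*} [Fintype α] : ∀ (M : ℕ) (K : Fin M → α → α → ℂ)
    (Ψ : Fin (M + 1) → α → ℂ)
    (_ : ∀ j b, ∑ a, Ψ j.castSucc a * K j a b = Ψ j.succ b) (f : α → ℂ),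
    ∑ p : Fin (M + 1) → α, Ψ 0 (p 0) * (∏ j, K j (p j.castSucc) (p j.succ)) * f (p (Fin.last M)) =
      ∑ b, Ψ (Fin.last M) b * f b
  | 0, K, Ψ, _, f => by
    rw [← (Equiv.funUnique (Fin 1) α).symm.sum_comp]
    simp
  | M + 1, K, Ψ, hΨ, f => by
    rw [← (Fin.consEquiv fun _ : Fin (M + 2) => α).sum_comp, Fintype.sum_prod_type_right,
      ← Fin.succ_last, ← sum_chain M (fun j => K j.succ) (fun j => Ψ j.succ)
        (fun j b => by simpa using hΨ j.succ b) f]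
    refine Finset.sum_congr rfl fun p _ => ?_
    rw [← Fin.castSucc_zero, Fin.castSucc_zero, ← hΨ 0 (p 0), Finset.sum_mul, Finset.sum_mul]
    refine Finset.sum_congr rfl fun a _ => ?_
    simp only [Fin.consEquiv_apply, Fin.prod_univ_succ, Fin.cons_zero, Fin.cons_succ,
      Fin.castSucc_zero, ← Fin.succ_castSucc]
    ring

/-! ### Path configurations as chains of states -/

theorem vertexWeight_eq_zero (x y r s : ℂ) {i₁ j₁ i₂ j₂ : Bool}
    (h : i₁.toNat + j₁.toNat ≠ i₂.toNat + j₂.toNat) : vertexWeight x y r s i₁ j₁ i₂ j₂ = 0 := by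
  cases i₁ <;> cases j₁ <;> cases i₂ <;> cases j₂ <;> simp_all [vertexWeight]

/-- Path conservation determines the horizontal states from left to right, so at most one term of
the sum hidden in `rowAmp` survives. -/
theorem rowAmp_of_preserve (x : ℂ) (y : ℕ → ℂ) (r : ℂ) (s : ℕ → ℂ) (σ τ : Finset ℕ)
    {hz : ℕ → Bool} (h0 : hz 0 = false) (n : ℕ)
    (hp : ∀ i < n, (decide (i ∈ σ)).toNat + (hz i).toNat =
      (decide (i ∈ τ)).toNat + (hz (i + 1)).toNat) (h' : Bool) :
    rowAmp x y r s σ τ n h' = if h' = hz n then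
      ∏ i ∈ Finset.range n, vertexWeight x (y i) r (s i) (decide (i ∈ σ)) (hz i)
        (decide (i ∈ τ)) (hz (i + 1)) else 0 := by
  induction n generalizing h' with
  | zero => cases h' <;> simp [rowAmp, h0]
  | succ n ih =>
    have ih := ih fun i hi => hp i (by omega)
    have hn := hp n (by omega)
    rw [rowAmp, ih, ih, Finset.prod_range_succ]
    by_cases hh : h' = hz (n + 1)
    · rw [if_pos hh, hh]
      cases hz n <;> simp
    · rw [if_neg hh]
      have : ∀ b, b = hz n → vertexWeight x (y n) r (s n) (decide (n ∈ σ)) b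
          (decide (n ∈ τ)) h' = 0 := by
        rintro b rfl
        refine vertexWeight_eq_zero _ _ _ _ fun he => hh ?_
        rw [hn] at he
        cases h' <;> cases hz (n + 1) <;> simp_all
      cases hb : hz n
      · simp [this false hb.symm]
      · simp [this true hb.symm]

theorem exists_preserve_of_rowAmp_ne_zero (x : ℂ) (y : ℕ → ℂ) (r : ℂ) (s : ℕ → ℂ)
    (σ τ : Finset ℕ) (n : ℕ) (h' : Bool) (hne : rowAmp x y r s σ τ n h' ≠ 0) :
    ∃ hz : ℕ → Bool, hz 0 = false ∧ hz n = h' ∧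
      ∀ i < n, (decide (i ∈ σ)).toNat + (hz i).toNat =
        (decide (i ∈ τ)).toNat + (hz (i + 1)).toNat := by
  induction n generalizing h' with
  | zero =>
    refine ⟨fun _ => false, rfl, ?_, by simp⟩
    cases h' <;> simp_all [rowAmp]
  | succ n ih =>
    have : ∃ b, rowAmp x y r s σ τ n b ≠ 0 ∧ vertexWeight x (y n) r (s n) (decide (n ∈ σ)) b
        (decide (n ∈ τ)) h' ≠ 0 := by
      by_contra hcon
      push Not at hcon
      apply hne
      rw [rowAmp]
      have hmul : ∀ b, rowAmp x y r s σ τ n b * vertexWeight x (y n) r (s n) (decide (n ∈ σ)) b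
          (decide (n ∈ τ)) h' = 0 := by
        intro b
        by_cases hb : rowAmp x y r s σ τ n b = 0
        · rw [hb, zero_mul]
        · rw [hcon b hb, mul_zero]
      rw [hmul, hmul, add_zero]
    obtain ⟨b, hb, hw⟩ := this
    obtain ⟨hz, h0, hn, hp⟩ := ih b hb
    refine ⟨Function.update hz (n + 1) h', ?_, by simp, ?_⟩
    · simp [h0]
    · intro i hi
      have hpw : (decide (n ∈ σ)).toNat + b.toNat = (decide (n ∈ τ)).toNat + h'.toNat := by
        by_contra hc
        exact hw (vertexWeight_eq_zero _ _ _ _ hc)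
      rcases Nat.lt_succ_iff_lt_or_eq.1 hi with hi | rfl
      · rw [Function.update_of_ne (by omega), Function.update_of_ne (by omega)]
        exact hp i hi
      · rw [Function.update_of_ne (by omega), Function.update_self, hn]
        exact hpw

namespace PathConfig

variable {M : ℕ} {S T : Set ℕ}

/-- A path on a horizontal edge beyond `L` cannot turn upwards there, so it would run to the right
forever, against the empty right boundary. -/
theorem horiz_eq_false (c : PathConfig M S T) {L : ℕ} {j : Fin M}
    (hv : ∀ i, L ≤ i → c.vert i j.succ = false) {i : ℕ} (hi : L ≤ i) : c.horiz i j = false := by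
  by_contra hne
  have hall : ∀ d, c.horiz (i + d) j = true := by
    intro d
    induction d with
    | zero => simpa using hne
    | succ d ih =>
      have := c.preserve (i + d) j
      rw [ih, hv _ (by omega)] at this
      by_contra hc
      rw [← add_assoc, Bool.not_eq_true] at hc
      simp [hc] at this
  obtain ⟨K, hK⟩ := c.right j
  have h1 := hK (i + K) (by omega)
  rw [hall K] at h1
  exact Bool.noConfusion h1

theorem vert_eq_false (c : PathConfig M S T) {L : ℕ} (hT : ∀ i ∈ T, i < L) (j : Fin (M + 1)) :
    ∀ i, L ≤ i → c.vert i j = false := by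
  induction j using Fin.reverseInduction with
  | last =>
    intro i hi
    by_contra hne
    have := hT i ((c.top i).1 (by simpa using hne))
    omega
  | cast j ih =>
    intro i hi
    have hp := c.preserve i j
    rw [ih i hi, c.horiz_eq_false ih hi, c.horiz_eq_false ih (show L ≤ i + 1 by omega)] at hp
    cases hc : c.vert i j.castSucc
    · rfl
    · simp [hc] at hp

/-- The states of the vertical edges in each row, as subsets of the first `L` columns. -/
def states (c : PathConfig M S T) (L : ℕ) (j : Fin (M + 1)) : (Finset.range L).powerset :=
  ⟨(Finset.range L).filter fun i => c.vert i j = true, by simp⟩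

theorem mem_states (c : PathConfig M S T) {L : ℕ} (hT : ∀ i ∈ T, i < L) (j : Fin (M + 1)) (i : ℕ) :
    i ∈ (c.states L j).1 ↔ c.vert i j = true := by
  simp only [states, Finset.mem_filter, Finset.mem_range, and_iff_right_iff_imp]
  intro hi
  by_contra hL
  rw [c.vert_eq_false hT j i (by omega)] at hi
  exact Bool.noConfusion hi

theorem states_injective {L : ℕ} (hT : ∀ i ∈ T, i < L) :
    Function.Injective fun c : PathConfig M S T => c.states L := by
  intro c c' hcc
  have hv : c.vert = c'.vert := by
    funext i j
    have h1 := c.mem_states hT j i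
    have h2 := c'.mem_states hT j i
    rw [show c.states L = c'.states L from hcc, h2] at h1
    exact (Bool.eq_iff_iff.2 h1).symm
  have hh : c.horiz = c'.horiz := by
    funext i j
    induction i with
    | zero => rw [c.left, c'.left]
    | succ i ih =>
      have h1 := c.preserve i j
      have h2 := c'.preserve i j
      rw [← hv, ← ih, h1] at h2
      have h3 := Nat.add_left_cancel h2
      cases ha : c.horiz (i + 1) j <;> cases hb : c'.horiz (i + 1) j <;> simp_all
  cases c
  cases c'
  simp_all

theorem weight_eq (c : PathConfig M S T) {L : ℕ} (hT : ∀ i ∈ T, i < L)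
    (x : Fin M → ℂ) (y : ℕ → ℂ) (r : Fin M → ℂ) (s : ℕ → ℂ) :
    c.weight x y r s = ∏ j : Fin M,
      rowAmp (x j) y (r j) s (c.states L j.castSucc).1 (c.states L j.succ).1 L false := by
  refine Finset.prod_congr rfl fun j _ => ?_
  have hd : ∀ i j, decide (i ∈ (c.states L j).1) = c.vert i j := fun i j => by
    rw [Bool.eq_iff_iff, decide_eq_true_iff, c.mem_states hT]
  have hh := fun i (hi : L ≤ i) => c.horiz_eq_false (c.vert_eq_false hT j.succ) hi
  rw [rowAmp_of_preserve (x j) y (r j) s _ _ (c.left j) L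
    (fun i _ => by simpa only [hd] using c.preserve i j), if_pos (hh L le_rfl).symm]
  simp only [hd]
  refine finprod_eq_prod_of_mulSupport_subset _ fun i hi => ?_
  by_contra hL
  have hL : L ≤ i := by simpa using hL
  refine hi ?_
  simp only [c.vert_eq_false hT _ i hL, hh i hL, hh (i + 1) (by omega)]
  rfl

/-- Chains of states that do not come from a configuration have weight zero, so the sum over
configurations may be replaced by the sum over all chains. -/
theorem mem_range_states {L : ℕ} (σ : Fin (M + 1) → (Finset.range L).powerset)
    (hS : ∀ i, i ∈ (σ 0).1 ↔ i ∈ S) (hT : ∀ i, i ∈ (σ (Fin.last M)).1 ↔ i ∈ T)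
    (x : Fin M → ℂ) (y : ℕ → ℂ) (r : Fin M → ℂ) (s : ℕ → ℂ)
    (hne : ∀ j : Fin M, rowAmp (x j) y (r j) s (σ j.castSucc).1 (σ j.succ).1 L false ≠ 0) :
    σ ∈ Set.range fun c : PathConfig M S T => c.states L := by
  choose hz h0 hL hp using fun j =>
    exists_preserve_of_rowAmp_ne_zero (x j) y (r j) s _ _ L false (hne j)
  have hlt : ∀ j i, i ∈ (σ j).1 → i < L := fun j i hi =>
    Finset.mem_range.1 (Finset.mem_powerset.1 (σ j).2 hi)
  -- Cutting the horizontal states off at column `L` is consistent, since the row amplitudes are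
  -- taken with the edge leaving the first `L` columns empty.
  refine ⟨{ vert := fun i j => decide (i ∈ (σ j).1)
            horiz := fun i j => if i < L then hz j i else false
            preserve := ?_
            bottom := fun i => by simpa using hS i
            top := fun i => by simpa using hT i
            left := fun j => by simp [h0]
            right := fun j => ⟨L, fun i hi => if_neg (by omega)⟩ }, ?_⟩
  · intro i j
    by_cases hi : i < L
    · have := hp j i hi
      rw [if_pos hi, this]
      by_cases hi' : i + 1 < L
      · rw [if_pos hi']
      · rw [if_neg hi', show i + 1 = L by omega, hL]
    · have h1 : ∀ j, i ∉ (σ j).1 := fun j hm => hi (hlt j i hm)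
      simp [h1, hi, show ¬ i + 1 < L by omega]
  · funext j
    apply Subtype.ext
    ext i
    simp only [states, Finset.mem_filter, Finset.mem_range, decide_eq_true_eq]
    exact ⟨fun h => h.2, fun h => ⟨hlt j i h, h⟩⟩

end PathConfig

/-! ### The partition function as a Slater determinant -/

theorem site_strictAnti {N : ℕ} {ν : Fin N → ℕ} (hν : Antitone ν) : StrictAnti (site ν) := by
  intro i j hij
  have := hν hij.le
  have h1 := i.2
  have h2 := j.2
  have h3 : (i : ℕ) < j := hij
  simp only [site]
  omega

/-- The partition function is the determinant of its one particle amplitudes. -/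
theorem skewG_eq_det {N M : ℕ} {lam ν : Fin N → ℕ} (hlam : Antitone lam) (hν : Antitone ν)
    (w : Fin M → ℂ) (y : ℕ → ℂ) (θ : Fin M → ℂ) (s : ℕ → ℂ)
    (hw : ∀ j i, (s i ^ 2)⁻¹ * y i - w j ≠ 0)
    (v : Fin (M + 1) → ℕ → Fin N → ℂ) (hv0 : v 0 = fun l j => if l = site lam j then 1 else 0)
    (hv : ∀ j : Fin M, v j.succ = rowEvolve (w j) y (θ j) s (v j.castSucc)) :
    skewG ν lam w y θ s = (Matrix.of fun i j => v (Fin.last M) (site ν i) j).det := by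
  classical
  have hsl := site_strictAnti hlam
  have hsn := site_strictAnti hν
  obtain ⟨L, hLl, hLn⟩ : ∃ L, (∀ i, site lam i < L) ∧ ∀ i, site ν i < L := by
    refine ⟨(∑ i, site lam i) + (∑ i, site ν i) + 1, fun i => ?_, fun i => ?_⟩
    · have := Finset.single_le_sum (f := site lam) (fun i _ => Nat.zero_le _) (Finset.mem_univ i)
      omega
    · have := Finset.single_le_sum (f := site ν) (fun i _ => Nat.zero_le _) (Finset.mem_univ i)
      omega
  have hT : ∀ i ∈ occupied ν, i < L := by
    rintro _ ⟨i, rfl⟩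
    exact hLn i
  let A : Finset ℕ := Finset.univ.image (site lam)
  let B : Finset ℕ := Finset.univ.image (site ν)
  have hA : A ∈ (Finset.range L).powerset := by
    simpa [A, Finset.image_subset_iff] using hLl
  have hB : B ∈ (Finset.range L).powerset := by
    simpa [B, Finset.image_subset_iff] using hLn
  have memA : ∀ i, i ∈ A ↔ i ∈ occupied lam := fun i => by simp [A, occupied]
  have memB : ∀ i, i ∈ B ↔ i ∈ occupied ν := fun i => by simp [B, occupied]
  let K : Fin M → (Finset.range L).powerset → (Finset.range L).powerset → ℂ :=
    fun j a b => rowAmp (w j) y (θ j) s a.1 b.1 L false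
  -- `Ψ m` assigns to each state the top-degree coefficient of the wedge of the amplitudes after `m`
  -- rows. It starts as the indicator of `A` and is transported by the row transfer matrices.
  let Ψ : Fin (M + 1) → (Finset.range L).powerset → ℂ := fun m a =>
    topForm N (ordProd (fun l => ExteriorAlgebra.ι ℂ (v m l)) a.1 L)
  let f : (Finset.range L).powerset → ℂ := fun b => if b = ⟨B, hB⟩ then 1 else 0
  have hlt : ∀ (a : (Finset.range L).powerset), ∀ i ∈ a.1, i < L := fun a i hi =>
    Finset.mem_range.1 (Finset.mem_powerset.1 a.2 hi)
  have hΨ0 : ∀ a, Ψ 0 a = if a.1 = A then 1 else 0 := by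
    intro a
    simp only [Ψ, hv0]
    exact topForm_ordProd_delta hsl (hlt a)
  have hΨ : ∀ j b, ∑ a, Ψ j.castSucc a * K j a b = Ψ j.succ b := by
    intro j b
    have h1 := sum_rowAmp_smul_ordProd (w j) y (θ j) s (hw j) (v j.castSucc) b.1 L false
    simp only [Ψ, K, hv]
    rw [← Finset.sum_coe_sort] at h1
    have h2 := congrArg (topForm N) h1
    simp only [map_sum, map_smul, smul_eq_mul, Bool.false_eq_true, if_false, mul_one] at h2
    rw [← h2]
    exact Finset.sum_congr rfl fun a _ => mul_comm _ _
  have hchain := sum_chain M K Ψ hΨ f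
  have hrhs : ∑ b, Ψ (Fin.last M) b * f b =
      (Matrix.of fun i j => v (Fin.last M) (site ν i) j).det := by
    simp only [f, mul_ite, mul_one, mul_zero, Finset.sum_ite_eq', Finset.mem_univ, if_true]
    exact topForm_ordProd _ hsn hLn
  rw [← hrhs, ← hchain, ← finsum_eq_sum_of_fintype, skewG]
  have hinj := PathConfig.states_injective (M := M) (S := occupied lam) hT
  let F : (Fin (M + 1) → (Finset.range L).powerset) → ℂ := fun p =>
    Ψ 0 (p 0) * (∏ j, K j (p j.castSucc) (p j.succ)) * f (p (Fin.last M))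
  have hF : ∀ c : PathConfig M (occupied lam) (occupied ν), c.weight w y θ s = F (c.states L) := by
    intro c
    have e0 : (c.states L 0).1 = A := by
      ext i
      rw [c.mem_states hT, c.bottom, memA]
    have e1 : c.states L (Fin.last M) = ⟨B, hB⟩ := by
      apply Subtype.ext
      ext i
      rw [c.mem_states hT, c.top, memB]
    simp only [F, f, hΨ0, if_pos e0, if_pos e1, one_mul, mul_one, K]
    exact c.weight_eq hT w y θ s
  simp only [hF]
  rw [← finsum_mem_range hinj (f := F)]
  -- The support of `F` lies in the range of `states`, so the sum extends to all chains.
  refine (finsum_mem_inter_support_eq F _ Set.univ ?_).trans (finsum_mem_univ F)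
  rw [Set.univ_inter]
  refine Set.inter_eq_right.2 fun p hp => ?_
  have hp : F p ≠ 0 := hp
  have h0 : (p 0).1 = A := by
    by_contra hc
    exact hp (by simp [F, hΨ0, hc])
  have hl : p (Fin.last M) = ⟨B, hB⟩ := by
    by_contra hc
    exact hp (by simp [F, f, hc])
  refine PathConfig.mem_range_states p (fun i => by rw [h0, memA])
    (fun i => by rw [hl, memB]) w y θ s fun j hj => hp ?_
  have : ∏ j, K j (p j.castSucc) (p j.succ) = 0 := Finset.prod_eq_zero (Finset.mem_univ j) hj
  simp [F, this]

/-! ### Contour integrals and formal integrals as linear functionals -/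

/-- `f` is holomorphic outside of a finite subset of `S`. -/
def FinDiff (S : Set ℂ) (f : ℂ → ℂ) : Prop :=
  ∃ F : Finset ℂ, (F : Set ℂ) ⊆ S ∧ DifferentiableOn ℂ f (F : Set ℂ)ᶜ

theorem FinDiff.add {S : Set ℂ} {f g : ℂ → ℂ} (hf : FinDiff S f) (hg : FinDiff S g) :
    FinDiff S fun z => f z + g z := by
  classical
  obtain ⟨F, hF, hf⟩ := hf
  obtain ⟨G, hG, hg⟩ := hg
  refine ⟨F ∪ G, by simp [hF, hG], ?_⟩
  exact (hf.mono fun z hz => by simp_all).add (hg.mono fun z hz => by simp_all)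

theorem FinDiff.mul {S : Set ℂ} {f g : ℂ → ℂ} (hf : FinDiff S f) (hg : FinDiff S g) :
    FinDiff S fun z => f z * g z := by
  classical
  obtain ⟨F, hF, hf⟩ := hf
  obtain ⟨G, hG, hg⟩ := hg
  refine ⟨F ∪ G, by simp [hF, hG], ?_⟩
  exact (hf.mono fun z hz => by simp_all).mul (hg.mono fun z hz => by simp_all)

theorem FinDiff.const (S : Set ℂ) (c : ℂ) : FinDiff S fun _ => c :=
  ⟨∅, by simp, differentiableOn_const c⟩

theorem FinDiff.inv_sub {S : Set ℂ} {p : ℂ} (hp : p ∈ S) : FinDiff S fun z => (z - p)⁻¹ := by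
  refine ⟨{p}, by simpa using hp, ?_⟩
  refine (differentiableOn_id.sub_const p).inv fun z hz => sub_ne_zero.2 ?_
  simpa using hz

theorem FinDiff.congr {S : Set ℂ} {f g : ℂ → ℂ} (hf : FinDiff S f) {F : Finset ℂ}
    (hF : (F : Set ℂ) ⊆ S) (hfg : ∀ z ∉ F, f z = g z) : FinDiff S g := by
  classical
  obtain ⟨G, hG, hf⟩ := hf
  refine ⟨F ∪ G, by simp [hF, hG], ?_⟩
  exact (hf.mono fun z hz => by simp_all).congr fun z hz => (hfg z (by simp_all)).symm

/-- The properties of `f ↦ (2πi)⁻¹ ∮ f(z) dz` for a contour that goes once around each point of `I`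
and leaves out the points of `O`, on functions with finitely many singularities in `I ∪ O`. -/
structure IsResidueFunctional (I O : Set ℂ) (J : (ℂ → ℂ) → ℂ) : Prop where
  congr : ∀ (f g : ℂ → ℂ) (F : Finset ℂ), (F : Set ℂ) ⊆ I ∪ O → (∀ z ∉ F, f z = g z) → J f = J g
  add : ∀ f g, FinDiff (I ∪ O) f → FinDiff (I ∪ O) g → J (fun z => f z + g z) = J f + J g
  const_mul : ∀ (c : ℂ) (f : ℂ → ℂ), FinDiff (I ∪ O) f → J (fun z => c * f z) = c * J f
  inv_inside : ∀ p ∈ I, J (fun z => (z - p)⁻¹) = 1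
  inv_outside : ∀ p ∈ O, J (fun z => (z - p)⁻¹) = 0
  pow : ∀ p ∈ I ∪ O, ∀ n, 2 ≤ n → J (fun z => ((z - p)⁻¹) ^ n) = 0

/-! ### Contour integrals as residue functionals -/

section Contour

open MeasureTheory

variable {γ : ℝ → ℂ}

theorem intervalIntegrable_comp_mul_deriv {a b : ℝ} (hab : a ≤ b)
    (hγ : ContDiffOn ℝ 1 γ (Set.Icc a b)) {f : ℂ → ℂ}
    (hf : ContinuousOn (fun t => f (γ t)) (Set.Icc a b)) :
    IntervalIntegrable (fun t => f (γ t) * deriv γ t) volume a b := by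
  rcases hab.eq_or_lt with rfl | hlt
  · exact IntervalIntegrable.refl
  · have hc := hf.mul (hγ.continuousOn_derivWithin (uniqueDiffOn_Icc hlt) le_rfl)
    rw [← Set.uIcc_of_le hab] at hc
    -- At the break points `deriv γ` need not be the one-sided derivative; it agrees with the
    -- continuous `derivWithin` on the open interval, which suffices.
    refine hc.intervalIntegrable.congr_uIoo fun t ht => ?_
    rw [Set.uIoo_of_le hab] at ht
    simp only [Pi.mul_apply]
    rw [derivWithin_of_mem_nhds]
    rw [Set.uIcc_of_le hab]
    exact Icc_mem_nhds ht.1 ht.2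

theorem integral_comp_mul_deriv_of_primitive {a b : ℝ} (hab : a ≤ b)
    (hγ : ContDiffOn ℝ 1 γ (Set.Icc a b)) {f G : ℂ → ℂ}
    (hf : ContinuousOn (fun t => f (γ t)) (Set.Icc a b))
    (hG : ∀ t ∈ Set.Icc a b, HasDerivAt G (f (γ t)) (γ t)) :
    ∫ t in a..b, f (γ t) * deriv γ t = G (γ b) - G (γ a) := by
  refine intervalIntegral.integral_eq_sub_of_hasDerivAt_of_le hab (f := fun t => G (γ t)) ?_ ?_
    (intervalIntegrable_comp_mul_deriv hab hγ hf)
  · intro t ht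
    exact (hG t ht).continuousAt.comp_continuousWithinAt (hγ.continuousOn t ht)
  · intro t ht
    have hd : DifferentiableAt ℝ γ t :=
      (hγ.differentiableOn one_ne_zero).differentiableAt (Icc_mem_nhds ht.1 ht.2)
    exact (hG t (Set.Ioo_subset_Icc_self ht)).comp_of_eq t hd.hasDerivAt rfl

theorem Icc_subset_of_monotone {n : ℕ} {t : ℕ → ℝ} (ht : Monotone t) (h0 : t 0 = 0) (h1 : t n = 1)
    {i : ℕ} (hi : i < n) : Set.Icc (t i) (t (i + 1)) ⊆ Set.Icc 0 1 :=
  Set.Icc_subset_Icc (h0 ▸ ht (Nat.zero_le i)) (h1 ▸ ht hi)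

theorem IsClosedContour.intervalIntegrable (hγ : IsClosedContour γ) {S : Set ℂ}
    (hS : ∀ p ∈ S, ∀ t ∈ Set.Icc (0 : ℝ) 1, γ t ≠ p) {f : ℂ → ℂ} (hf : FinDiff S f) :
    IntervalIntegrable (fun t => f (γ t) * deriv γ t) volume 0 1 := by
  obtain ⟨-, n, t, ht, h0, h1, hC⟩ := hγ
  obtain ⟨F, hF, hf⟩ := hf
  rw [← h0, ← h1]
  refine IntervalIntegrable.trans_iterate fun i hi =>
    intervalIntegrable_comp_mul_deriv (ht (Nat.le_succ i)) (hC i hi) ?_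
  refine hf.continuousOn.comp (hC i hi).continuousOn fun τ hτ hm => ?_
  exact hS _ (hF hm) τ (Icc_subset_of_monotone ht h0 h1 hi hτ) rfl

theorem IsClosedContour.integral_eq_zero (hγ : IsClosedContour γ) {f G : ℂ → ℂ}
    (hf : ∀ t ∈ Set.Icc (0 : ℝ) 1, ContinuousAt f (γ t))
    (hG : ∀ t ∈ Set.Icc (0 : ℝ) 1, HasDerivAt G (f (γ t)) (γ t)) :
    ∫ t in (0 : ℝ)..1, f (γ t) * deriv γ t = 0 := by
  obtain ⟨hcl, n, t, ht, h0, h1, hC⟩ := hγ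
  have hsub := fun i hi => Icc_subset_of_monotone ht h0 h1 (i := i) hi
  have hcont : ∀ i < n, ContinuousOn (fun τ => f (γ τ)) (Set.Icc (t i) (t (i + 1))) :=
    fun i hi τ hτ =>
      (hf τ (hsub i hi hτ)).comp_continuousWithinAt ((hC i hi).continuousOn τ hτ)
  have hsum := intervalIntegral.sum_integral_adjacent_intervals (a := t) (n := n) fun i hi =>
    intervalIntegrable_comp_mul_deriv (ht (Nat.le_succ i)) (hC i hi) (hcont i hi)
  rw [h0, h1] at hsum
  rw [← hsum, Finset.sum_congr rfl fun i hi =>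
    integral_comp_mul_deriv_of_primitive (ht (Nat.le_succ i)) (hC i (Finset.mem_range.1 hi))
      (hcont i (Finset.mem_range.1 hi)) fun τ hτ => hG τ (hsub i (Finset.mem_range.1 hi) hτ),
    Finset.sum_range_sub (fun i => G (γ (t i))), h0, h1, hcl, sub_self]

theorem hasDerivAt_inv_sub_pow {z p : ℂ} (hz : z ≠ p) (n : ℕ) :
    HasDerivAt (fun z => -((n + 1 : ℕ) : ℂ)⁻¹ * ((z - p)⁻¹) ^ (n + 1)) (((z - p)⁻¹) ^ (n + 2)) z := by
  have hz' : z - p ≠ 0 := sub_ne_zero.2 hz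
  have h1 : HasDerivAt (fun z => (z - p)⁻¹) (-1 / (z - p) ^ 2) z :=
    ((hasDerivAt_id z).sub_const p).inv hz'
  refine ((h1.pow (n + 1)).const_mul (-((n + 1 : ℕ) : ℂ)⁻¹)).congr_deriv ?_
  have : ((n + 1 : ℕ) : ℂ) ≠ 0 := Nat.cast_ne_zero.2 n.succ_ne_zero
  rw [Nat.add_sub_cancel, neg_div, one_div, ← inv_pow]
  generalize (z - p)⁻¹ = u
  field_simp
  ring

theorem IsClosedContour.isResidueFunctional (hγ : IsClosedContour γ) {I O : Set ℂ}
    (hI : ∀ p ∈ I, HasWinding γ p 1) (hO : ∀ p ∈ O, HasWinding γ p 0) :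
    IsResidueFunctional I O (contourIntegral γ) := by
  have hS : ∀ p ∈ I ∪ O, ∀ t ∈ Set.Icc (0 : ℝ) 1, γ t ≠ p := by
    rintro p (hp | hp)
    exacts [(hI p hp).1, (hO p hp).1]
  refine ⟨?_, ?_, ?_, ?_, ?_, ?_⟩
  · intro f g F hF hfg
    simp only [contourIntegral]
    congr 1
    refine intervalIntegral.integral_congr fun t ht => ?_
    rw [Set.uIcc_of_le zero_le_one] at ht
    rw [hfg _ fun hm => hS _ (hF hm) t ht rfl]
  · intro f g hf hg
    simp only [contourIntegral, add_mul]
    rw [intervalIntegral.integral_add (hγ.intervalIntegrable hS hf)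
      (hγ.intervalIntegrable hS hg), mul_add]
  · intro c f _
    simp only [contourIntegral, mul_assoc c]
    rw [intervalIntegral.integral_const_mul, mul_left_comm]
  · intro p hp
    simpa using (hI p hp).2
  · intro p hp
    simpa using (hO p hp).2
  · intro p hp n hn
    obtain ⟨n, rfl⟩ := Nat.exists_eq_add_of_le' hn
    have hne : ∀ t ∈ Set.Icc (0 : ℝ) 1, γ t - p ≠ 0 := fun t ht => sub_ne_zero.2 (hS p hp t ht)
    rw [contourIntegral, hγ.integral_eq_zero (f := fun z => ((z - p)⁻¹) ^ (n + 2)), mul_zero]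
    · exact fun t ht => ((continuousAt_id.sub continuousAt_const).inv₀ (hne t ht)).pow _
    -- Powers of order at least two have a single-valued primitive, so their integrals over a closed
    -- curve vanish.
    · exact fun t ht => hasDerivAt_inv_sub_pow (hS p hp t ht) n

end Contour

/-! ### Sums of residues as residue functionals -/

section Formal

/-- `f` is integrable over small circles about `p`, and these integrals have the value `c`. -/
def HasResidue (f : ℂ → ℂ) (p c : ℂ) : Prop :=
  ∀ᶠ ρ in 𝓝[>] (0 : ℝ), CircleIntegrable f p ρ ∧ (2 * π * Complex.I)⁻¹ * (∮ z in C(p, ρ), f z) = c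

theorem HasResidue.residue_eq {f : ℂ → ℂ} {p c : ℂ} (h : HasResidue f p c) : residue f p = c :=
  (tendsto_const_nhds.congr' (h.mono fun _ hρ => hρ.2.symm)).limUnder_eq

theorem HasResidue.add {f g : ℂ → ℂ} {p c d : ℂ} (hf : HasResidue f p c) (hg : HasResidue g p d) :
    HasResidue (fun z => f z + g z) p (c + d) := by
  filter_upwards [hf, hg] with ρ h1 h2
  refine ⟨h1.1.add h2.1, ?_⟩
  rw [circleIntegral.integral_add h1.1 h2.1, mul_add, h1.2, h2.2]

theorem residue_const_mul (f : ℂ → ℂ) (p a : ℂ) {c : ℂ} (hf : HasResidue f p c) :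
    residue (fun z => a * f z) p = a * residue f p := by
  rw [hf.residue_eq]
  refine HasResidue.residue_eq ?_
  filter_upwards [hf] with ρ h1
  refine ⟨h1.1.const_smul (a := a), ?_⟩
  rw [circleIntegral.integral_const_mul, mul_left_comm, h1.2]

theorem exists_closedBall_disjoint (F : Finset ℂ) (p : ℂ) :
    ∃ R > 0, ∀ z ∈ Metric.closedBall p R, z ≠ p → z ∉ F := by
  classical
  have : ((F.erase p : Finset ℂ) : Set ℂ)ᶜ ∈ 𝓝 p :=
    (F.erase p).finite_toSet.isClosed.isOpen_compl.mem_nhds (by simp)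
  obtain ⟨R, hR, h⟩ := Metric.nhds_basis_closedBall.mem_iff.1 this
  exact ⟨R, hR, fun z hz hzp hm => h hz (by simp [hzp, hm])⟩

theorem residue_congr {f g : ℂ → ℂ} {F : Finset ℂ} (hfg : ∀ z ∉ F, f z = g z) (p : ℂ) :
    residue f p = residue g p := by
  obtain ⟨R, hR, hF⟩ := exists_closedBall_disjoint F p
  have : (fun ρ : ℝ => (2 * π * Complex.I)⁻¹ * ∮ z in C(p, ρ), f z) =ᶠ[𝓝[>] (0 : ℝ)]
      fun ρ => (2 * π * Complex.I)⁻¹ * ∮ z in C(p, ρ), g z := by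
    filter_upwards [Ioc_mem_nhdsGT hR] with ρ hρ
    rw [circleIntegral.integral_congr hρ.1.le fun z hz => hfg z (hF z
      (Metric.closedBall_subset_closedBall hρ.2 (Metric.sphere_subset_closedBall hz)) ?_)]
    exact Metric.ne_of_mem_sphere hz hρ.1.ne'
  rw [residue, residue, Filter.limUnder, Filter.limUnder, Filter.map_congr this]

/-- With finitely many singularities, some punctured disc about `p` is free of them, and the circle
integrals there do not depend on the radius. -/
theorem exists_hasResidue {f : ℂ → ℂ} {F : Finset ℂ} (hf : DifferentiableOn ℂ f (F : Set ℂ)ᶜ)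
    (p : ℂ) : ∃ c, HasResidue f p c := by
  obtain ⟨R, hR, hF⟩ := exists_closedBall_disjoint F p
  refine ⟨(2 * π * Complex.I)⁻¹ * ∮ z in C(p, R), f z, ?_⟩
  have hopen : IsOpen ((F : Set ℂ)ᶜ) := F.finite_toSet.isClosed.isOpen_compl
  have hd : ∀ z ∈ Metric.closedBall p R, z ≠ p → DifferentiableAt ℂ f z := fun z hz hzp =>
    hf.differentiableAt (hopen.mem_nhds (hF z hz hzp))
  filter_upwards [Ioc_mem_nhdsGT hR] with ρ hρ
  constructor
  · refine ContinuousOn.circleIntegrable hρ.1.le fun z hz => ?_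
    exact (hd z (Metric.closedBall_subset_closedBall hρ.2 (Metric.sphere_subset_closedBall hz))
      (Metric.ne_of_mem_sphere hz hρ.1.ne')).continuousAt.continuousWithinAt
  · rw [Complex.circleIntegral_eq_of_differentiable_on_annulus_off_countable hρ.1 hρ.2
      Set.countable_empty (f := f)]
    · intro z hz
      refine (hd z hz.1 ?_).continuousAt.continuousWithinAt
      rintro rfl
      exact hz.2 (Metric.mem_ball_self hρ.1)
    · intro z hz
      refine hd z (Metric.ball_subset_closedBall hz.1.1) ?_
      rintro rfl
      exact hz.1.2 (Metric.mem_closedBall_self hρ.1.le)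

theorem hasResidue_zero {f : ℂ → ℂ} {F : Finset ℂ} (hf : DifferentiableOn ℂ f (F : Set ℂ)ᶜ)
    {p : ℂ} (hp : p ∉ F) : HasResidue f p 0 := by
  obtain ⟨R, hR, hF⟩ := exists_closedBall_disjoint F p
  have hopen : IsOpen ((F : Set ℂ)ᶜ) := F.finite_toSet.isClosed.isOpen_compl
  have hd : ∀ z ∈ Metric.closedBall p R, DifferentiableAt ℂ f z := fun z hz =>
    hf.differentiableAt (hopen.mem_nhds (by
      by_cases hzp : z = p
      · rw [hzp]; exact hp
      · exact hF z hz hzp))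
  filter_upwards [Ioc_mem_nhdsGT hR] with ρ hρ
  have hd' : ∀ z ∈ Metric.closedBall p ρ, DifferentiableAt ℂ f z := fun z hz =>
    hd z (Metric.closedBall_subset_closedBall hρ.2 hz)
  constructor
  · exact ContinuousOn.circleIntegrable hρ.1.le fun z hz =>
      (hd' z (Metric.sphere_subset_closedBall hz)).continuousAt.continuousWithinAt
  · rw [Complex.circleIntegral_eq_zero_of_differentiable_on_off_countable hρ.1.le
      Set.countable_empty, mul_zero]
    · exact fun z hz => (hd' z hz).continuousAt.continuousWithinAt
    · exact fun z hz => hd' z (Metric.ball_subset_closedBall hz.1)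

theorem residue_inv_sub_self (p : ℂ) : residue (fun z => (z - p)⁻¹) p = 1 := by
  refine Filter.Tendsto.limUnder_eq (tendsto_const_nhds.congr' ?_)
  filter_upwards [self_mem_nhdsWithin] with ρ hρ
  rw [circleIntegral.integral_sub_center_inv p (ne_of_gt hρ), inv_mul_cancel₀]
  simp [Real.pi_ne_zero]

theorem residue_inv_sub_pow_self (p : ℂ) {n : ℕ} (hn : 2 ≤ n) :
    residue (fun z => ((z - p)⁻¹) ^ n) p = 0 := by
  refine Filter.Tendsto.limUnder_eq (tendsto_const_nhds.congr fun ρ => ?_)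
  have : (fun z : ℂ => ((z - p)⁻¹) ^ n) = fun z => (z - p) ^ (-(n : ℤ)) := by
    funext z
    rw [zpow_neg, zpow_natCast, inv_pow]
  rw [this, circleIntegral.integral_sub_zpow_of_ne (by omega), mul_zero]

theorem differentiableOn_inv_sub_pow (p : ℂ) (n : ℕ) :
    DifferentiableOn ℂ (fun z => ((z - p)⁻¹) ^ n) (({p} : Finset ℂ) : Set ℂ)ᶜ :=
  ((differentiableOn_id.sub_const p).inv fun z hz => sub_ne_zero.2 (by simpa using hz)).pow n

theorem formalIntegral_isResidueFunctional {I O : Set ℂ} (hdisj : Disjoint I O) :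
    IsResidueFunctional I O (formalIntegral I) := by
  -- `I` may be infinite, but only the finitely many singularities of `f` carry nonzero residues;
  -- additivity of the sum needs this.
  have hfin : ∀ {f : ℂ → ℂ}, FinDiff (I ∪ O) f → (I ∩ Function.support (residue f)).Finite := by
    rintro f ⟨F, -, hf⟩
    refine F.finite_toSet.subset fun p hp => ?_
    by_contra hpF
    exact hp.2 (hasResidue_zero hf hpF).residue_eq
  refine ⟨?_, ?_, ?_, ?_, ?_, ?_⟩
  · intro f g F _ hfg
    exact finsum_mem_congr rfl fun p _ => residue_congr hfg p
  · intro f g hf hg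
    rw [formalIntegral, formalIntegral, formalIntegral, ← finsum_mem_add_distrib' (hfin hf) (hfin hg)]
    refine finsum_mem_congr rfl fun p _ => ?_
    obtain ⟨c, hc⟩ := exists_hasResidue hf.choose_spec.2 p
    obtain ⟨d, hd⟩ := exists_hasResidue hg.choose_spec.2 p
    rw [(hc.add hd).residue_eq, hc.residue_eq, hd.residue_eq]
  · intro c f hf
    rw [formalIntegral, formalIntegral, mul_finsum_mem]
    refine finsum_mem_congr rfl fun p _ => ?_
    obtain ⟨d, hd⟩ := exists_hasResidue hf.choose_spec.2 p
    exact residue_const_mul f p c hd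
  · intro p hp
    have hd := differentiableOn_inv_sub_pow p 1
    simp only [pow_one] at hd
    rw [formalIntegral, finsum_mem_inter_support_eq' _ I {p}, finsum_mem_singleton,
      residue_inv_sub_self]
    intro q hq
    have hqp : q = p := by
      by_contra hqp
      exact hq (hasResidue_zero hd (by simpa using hqp)).residue_eq
    simp [hqp, hp]
  · intro p hp
    refine finsum_mem_eq_zero_of_forall_eq_zero fun q hq => ?_
    have := differentiableOn_inv_sub_pow p 1
    simp only [pow_one] at this
    exact (hasResidue_zero this (by
      rw [Finset.mem_singleton]; rintro rfl; exact Set.disjoint_left.1 hdisj hq hp)).residue_eq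
  · intro p _ n hn
    refine finsum_mem_eq_zero_of_forall_eq_zero fun q _ => ?_
    by_cases hqp : q = p
    · rw [hqp]; exact residue_inv_sub_pow_self p hn
    · exact (hasResidue_zero (differentiableOn_inv_sub_pow p n) (by simpa using hqp)).residue_eq

end Formal

/-! ### Decaying rational functions -/

/-- The function `z ↦ ∏ (z - b)⁻¹`, where `b` runs through `m`. -/
def invProd (m : Multiset ℂ) : ℂ → ℂ := fun z => (m.map fun b => (z - b)⁻¹).prod

/-- The span of the functions `∏ (z - b)⁻¹` with at least `n` factors and all `b` in `I`. -/
def decSpan (I : Set ℂ) (n : ℕ) : Submodule ℂ (ℂ → ℂ) :=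
  Submodule.span ℂ {f | ∃ m : Multiset ℂ, (∀ b ∈ m, b ∈ I) ∧ n ≤ m.card ∧ f = invProd m}

/-- Outside of a finite subset of `S`, the function `f` is a rational function with poles in `I`
that vanishes at infinity to order at least `n`. -/
def Dec (S I : Set ℂ) (n : ℕ) (f : ℂ → ℂ) : Prop :=
  ∃ g ∈ decSpan I n, ∃ F : Finset ℂ, (F : Set ℂ) ⊆ S ∧ ∀ z ∉ F, f z = g z

theorem invProd_cons (b : ℂ) (m : Multiset ℂ) (z : ℂ) :
    invProd (b ::ₘ m) z = (z - b)⁻¹ * invProd m z := by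
  simp [invProd]

theorem invProd_add (m m' : Multiset ℂ) : invProd (m + m') = invProd m * invProd m' := by
  funext z
  simp [invProd]

theorem mul_mem_decSpan {I : Set ℂ} {n n' : ℕ} {f g : ℂ → ℂ} (hf : f ∈ decSpan I n)
    (hg : g ∈ decSpan I n') : f * g ∈ decSpan I (n + n') := by
  have h := Submodule.mul_mem_mul hf hg
  rw [decSpan, decSpan, Submodule.span_mul_span] at h
  refine Submodule.span_mono ?_ h
  rintro _ ⟨_, ⟨m, hm, hn, rfl⟩, _, ⟨m', hm', hn', rfl⟩, rfl⟩
  refine ⟨m + m', fun b hb => ?_, ?_, (invProd_add m m').symm⟩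
  · rcases Multiset.mem_add.1 hb with hb | hb
    exacts [hm b hb, hm' b hb]
  · rw [Multiset.card_add]
    exact Nat.add_le_add hn hn'

namespace Dec

variable {S I : Set ℂ} {n : ℕ} {f g : ℂ → ℂ}

theorem congr (hf : Dec S I n f) {F : Finset ℂ} (hF : (F : Set ℂ) ⊆ S)
    (hfg : ∀ z ∉ F, f z = g z) : Dec S I n g := by
  classical
  obtain ⟨f', hf', G, hG, h⟩ := hf
  refine ⟨f', hf', F ∪ G, by simp [hF, hG], fun z hz => ?_⟩
  simp only [Finset.mem_union, not_or] at hz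
  rw [← hfg z hz.1, h z hz.2]

theorem mono {I' : Set ℂ} {n' : ℕ} (hI : I ⊆ I') (hn : n' ≤ n) (hf : Dec S I n f) :
    Dec S I' n' f := by
  obtain ⟨f', hf', hG⟩ := hf
  refine ⟨f', Submodule.span_mono ?_ hf', hG⟩
  rintro _ ⟨m, hm, hmn, rfl⟩
  exact ⟨m, fun b hb => hI (hm b hb), hn.trans hmn, rfl⟩

theorem add (hf : Dec S I n f) (hg : Dec S I n g) : Dec S I n fun z => f z + g z := by
  classical
  obtain ⟨f', hf', F, hF, h⟩ := hf
  obtain ⟨g', hg', G, hG, h'⟩ := hg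
  refine ⟨f' + g', add_mem hf' hg', F ∪ G, by simp [hF, hG], fun z hz => ?_⟩
  simp only [Finset.mem_union, not_or] at hz
  simp only [Pi.add_apply, h z hz.1, h' z hz.2]

theorem mul {n' : ℕ} (hf : Dec S I n f) (hg : Dec S I n' g) :
    Dec S I (n + n') fun z => f z * g z := by
  classical
  obtain ⟨f', hf', F, hF, h⟩ := hf
  obtain ⟨g', hg', G, hG, h'⟩ := hg
  refine ⟨f' * g', mul_mem_decSpan hf' hg', F ∪ G, by simp [hF, hG], fun z hz => ?_⟩
  simp only [Finset.mem_union, not_or] at hz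
  simp only [Pi.mul_apply, h z hz.1, h' z hz.2]

theorem const (S I : Set ℂ) (c : ℂ) : Dec S I 0 fun _ => c := by
  refine ⟨c • invProd 0, Submodule.smul_mem _ _ (Submodule.subset_span ⟨0, by simp, by simp, rfl⟩),
    ∅, by simp, fun z _ => by simp [invProd]⟩

theorem const_mul (c : ℂ) (hf : Dec S I n f) : Dec S I n fun z => c * f z := by
  simpa using (const S I c).mul hf

theorem inv_sub (S : Set ℂ) {p : ℂ} (hp : p ∈ I) : Dec S I 1 fun z => (z - p)⁻¹ := by
  refine ⟨invProd {p}, Submodule.subset_span ⟨{p}, by simpa using hp, by simp, rfl⟩,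
    ∅, by simp, fun z _ => by simp [invProd]⟩

/-- Away from `p` the quotient is `1 + (p - a) (z - p)⁻¹`. -/
theorem sub_mul_inv_sub (hI : I ⊆ S) (a : ℂ) {p : ℂ} (hp : p ∈ I) :
    Dec S I 0 fun z => (z - a) * (z - p)⁻¹ := by
  refine ((const S I 1).add (((inv_sub S hp).const_mul (p - a)).mono subset_rfl zero_le_one)).congr
    (F := {p}) (by simpa using hI hp) fun z hz => ?_
  have : z - p ≠ 0 := sub_ne_zero.2 (by simpa using hz)
  field_simp
  ring

theorem prod {ι : Type*} (A : Finset ι) {F : ι → ℂ → ℂ} (hF : ∀ i ∈ A, Dec S I 0 (F i)) :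
    Dec S I 0 fun z => ∏ i ∈ A, F i z := by
  classical
  induction A using Finset.induction_on with
  | empty => simpa using const S I 1
  | insert a A ha ih =>
    simp only [Finset.prod_insert ha]
    have h := Dec.mul (n := 0) (n' := 0) (f := F a) (g := fun z => ∏ i ∈ A, F i z)
      (hF a (Finset.mem_insert_self a A)) (ih fun i hi => hF i (Finset.mem_insert_of_mem hi))
    exact h

end Dec

/-! ### Vanishing of residue functionals on decaying rational functions -/

theorem finDiff_invProd {S : Set ℂ} {m : Multiset ℂ} (hm : ∀ b ∈ m, b ∈ S) :
    FinDiff S (invProd m) := by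
  induction m using Multiset.induction_on with
  | empty => exact FinDiff.const S _
  | cons a m ih =>
    have h1 := (FinDiff.inv_sub (hm a (by simp))).mul (ih fun b hb => hm b (by simp [hb]))
    simpa only [← invProd_cons] using h1

theorem Dec.finDiff {S I : Set ℂ} (hI : I ⊆ S) {n : ℕ} {f : ℂ → ℂ} (hf : Dec S I n f) :
    FinDiff S f := by
  obtain ⟨g, hg, F, hF, h⟩ := hf
  refine FinDiff.congr ?_ hF fun z hz => (h z hz).symm
  clear h hF
  induction hg using Submodule.span_induction with
  | mem g hg =>
    obtain ⟨m, hm, -, rfl⟩ := hg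
    exact finDiff_invProd fun b hb => hI (hm b hb)
  | zero => exact FinDiff.const S 0
  | add f g _ _ hf hg => exact hf.add hg
  | smul c f _ hf => exact (FinDiff.const S c).mul hf

namespace IsResidueFunctional

variable {I O : Set ℂ} {J : (ℂ → ℂ) → ℂ}

/-- Two distinct poles are separated by partial fractions with opposite coefficients `(a - b)⁻¹` and
`-(a - b)⁻¹`. This lowers the number of factors until two simple poles with the same value `c`
cancel; if all poles coincide, the function is a pure power. The cases of use are `c = 1` inside and
`c = 0` outside. -/
theorem apply_invProd (hJ : IsResidueFunctional I O J) {K : Set ℂ} (hK : K ⊆ I ∪ O) {c : ℂ}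
    (hc : ∀ p ∈ K, J (fun z => (z - p)⁻¹) = c) : ∀ (n : ℕ) (m : Multiset ℂ),
    m.card = n + 2 → (∀ b ∈ m, b ∈ K) → J (invProd m) = 0 := by
  intro n
  induction n with
  | zero =>
    intro m hm hmK
    obtain ⟨a, b, rfl⟩ := Multiset.card_eq_two.1 hm
    have ha := hmK a (by simp)
    have hb := hmK b (by simp)
    by_cases hab : a = b
    · subst hab
      rw [← hJ.pow a (hK ha) 2 le_rfl]
      congr 1
      funext z
      simp [invProd, sq]
    · have h1 := hJ.congr (invProd {a, b})
        (fun z => (a - b)⁻¹ * (z - a)⁻¹ + -(a - b)⁻¹ * (z - b)⁻¹) {a, b}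
        (by intro x hx; rcases (by simpa using hx : x = a ∨ x = b) with rfl | rfl
            exacts [hK ha, hK hb]) (by
          intro z hz
          simp only [Finset.mem_insert, Finset.mem_singleton, not_or] at hz
          have hza := sub_ne_zero.2 hz.1
          have hzb := sub_ne_zero.2 hz.2
          have hab := sub_ne_zero.2 hab
          simp only [invProd, Multiset.insert_eq_cons, Multiset.map_cons, Multiset.map_singleton,
            Multiset.prod_cons, Multiset.prod_singleton]
          field_simp
          ring)
      have fa := FinDiff.inv_sub (hK ha)
      have fb := FinDiff.inv_sub (hK hb)
      rw [h1, hJ.add _ _ ((FinDiff.const _ _).mul fa) ((FinDiff.const _ _).mul fb),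
        hJ.const_mul _ _ fa, hJ.const_mul _ _ fb, hc a ha, hc b hb]
      ring
  | succ n ih =>
    intro m hm hmK
    by_cases hall : ∃ a ∈ m, ∃ b ∈ m, a ≠ b
    · obtain ⟨a, ha, b, hb, hab⟩ := hall
      obtain ⟨m, rfl⟩ := Multiset.exists_cons_of_mem ha
      have hb' : b ∈ m := (Multiset.mem_cons.1 hb).resolve_left (Ne.symm hab)
      obtain ⟨m, rfl⟩ := Multiset.exists_cons_of_mem hb'
      have ha := hmK a (by simp)
      have hb := hmK b (by simp)
      have hm' : ∀ x ∈ m, x ∈ K := fun x hx => hmK x (by simp [hx])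
      have h1 := hJ.congr (invProd (a ::ₘ b ::ₘ m))
        (fun z => (a - b)⁻¹ * invProd (a ::ₘ m) z + -(a - b)⁻¹ * invProd (b ::ₘ m) z) {a, b}
        (by intro x hx; rcases (by simpa using hx : x = a ∨ x = b) with rfl | rfl
            exacts [hK ha, hK hb]) (by
          intro z hz
          simp only [Finset.mem_insert, Finset.mem_singleton, not_or] at hz
          have hza := sub_ne_zero.2 hz.1
          have hzb := sub_ne_zero.2 hz.2
          have hab := sub_ne_zero.2 hab
          simp only [invProd_cons]
          field_simp
          ring)
      have ma : ∀ x ∈ a ::ₘ m, x ∈ K := by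
        intro x hx
        rcases Multiset.mem_cons.1 hx with rfl | hx
        exacts [ha, hm' x hx]
      have mb : ∀ x ∈ b ::ₘ m, x ∈ K := by
        intro x hx
        rcases Multiset.mem_cons.1 hx with rfl | hx
        exacts [hb, hm' x hx]
      have fa := finDiff_invProd fun x hx => hK (ma x hx)
      have fb := finDiff_invProd fun x hx => hK (mb x hx)
      simp only [Multiset.card_cons] at hm
      rw [h1, hJ.add _ _ ((FinDiff.const _ _).mul fa) ((FinDiff.const _ _).mul fb),
        hJ.const_mul _ _ fa, hJ.const_mul _ _ fb, ih _ (by simp; omega) ma,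
        ih _ (by simp; omega) mb]
      ring
    · push Not at hall
      obtain ⟨a, ha⟩ := Multiset.card_pos_iff_exists_mem.1 (by omega : 0 < m.card)
      rw [Multiset.eq_replicate_card.2 fun b hb => hall b hb a ha,
        ← hJ.pow a (hK (hmK a ha)) m.card (by omega)]
      congr 1
      funext z
      simp [invProd]

theorem apply_eq_zero_of_forall (hJ : IsResidueFunctional I O J) {K : Set ℂ} (hK : K ⊆ I ∪ O)
    {n : ℕ} (hn : ∀ m : Multiset ℂ, (∀ b ∈ m, b ∈ K) → n ≤ m.card → J (invProd m) = 0)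
    {f : ℂ → ℂ} (hf : Dec (I ∪ O) K n f) : J f = 0 := by
  obtain ⟨g, hg, F, hF, h⟩ := hf
  rw [hJ.congr f g F hF h]
  suffices FinDiff (I ∪ O) g ∧ J g = 0 from this.2
  clear h hF
  induction hg using Submodule.span_induction with
  | mem g hg =>
    obtain ⟨m, hm, hmn, rfl⟩ := hg
    exact ⟨finDiff_invProd fun b hb => hK (hm b hb), hn m hm hmn⟩
  | zero =>
    refine ⟨FinDiff.const _ 0, ?_⟩
    have := hJ.const_mul 0 (fun _ => 0) (FinDiff.const _ 0)
    simp only [zero_mul] at this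
    exact this
  | add f g _ _ hf hg =>
    refine ⟨hf.1.add hg.1, (hJ.add f g hf.1 hg.1).trans ?_⟩
    rw [hf.2, hg.2, add_zero]
  | smul c f _ hf =>
    refine ⟨(FinDiff.const _ c).mul hf.1, (hJ.const_mul c f hf.1).trans ?_⟩
    rw [hf.2, mul_zero]

/-- The algebraic form of moving the contour to infinity. -/
theorem eq_zero_of_dec_inside (hJ : IsResidueFunctional I O J) {f : ℂ → ℂ}
    (hf : Dec (I ∪ O) I 2 f) : J f = 0 := by
  refine hJ.apply_eq_zero_of_forall Set.subset_union_left (fun m hm hn => ?_) hf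
  obtain ⟨n, hn⟩ := Nat.exists_eq_add_of_le' hn
  exact hJ.apply_invProd Set.subset_union_left hJ.inv_inside n m hn hm

/-- The algebraic form of contracting the contour to a point. Order one is enough, since even a
simple pole outside contributes nothing. -/
theorem eq_zero_of_dec_outside (hJ : IsResidueFunctional I O J) {f : ℂ → ℂ}
    (hf : Dec (I ∪ O) O 1 f) : J f = 0 := by
  refine hJ.apply_eq_zero_of_forall Set.subset_union_right (fun m hm hn => ?_) hf
  rcases hn.eq_or_lt with hn | hn
  · obtain ⟨a, rfl⟩ := Multiset.card_eq_one.1 hn.symm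
    rw [← hJ.inv_outside a (hm a (by simp))]
    congr 1
    funext z
    simp [invProd]
  · obtain ⟨n, hn⟩ := Nat.exists_eq_add_of_le' hn
    exact hJ.apply_invProd Set.subset_union_right hJ.inv_outside n m hn hm

end IsResidueFunctional

/-! ### The biorthogonal functions -/

/-- The functions dual to `psi`. -/
def phi (k : ℕ) (z : ℂ) (y s : ℕ → ℂ) : ℂ :=
  (y k - z)⁻¹ * ∏ j ∈ Finset.range k, (y j - s j ^ 2 * z) / (s j ^ 2 * (y j - z))

/-- The part of the integrand that depends on the row parameters in `A`. -/
def rowFactor {M : ℕ} (A : Finset (Fin M)) (z : ℂ) (w θ : Fin M → ℂ) : ℂ :=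
  ∏ i ∈ A, (z - (θ i ^ 2)⁻¹ * w i) / (z - w i)

/-- The points inside the contour. -/
def inner {M : ℕ} (w : Fin M → ℂ) (y : ℕ → ℂ) : Set ℂ := Set.range y ∪ Set.range w

/-- The points outside of the contour. -/
def outer (y s : ℕ → ℂ) : Set ℂ := Set.range fun k => (s k ^ 2)⁻¹ * y k

/-- The singularities that belong to the first `K` columns. -/
def singular {M : ℕ} (w : Fin M → ℂ) (y s : ℕ → ℂ) (K : ℕ) : Finset ℂ :=
  (Finset.range K).image y ∪ Finset.univ.image w ∪
    (Finset.range K).image fun k => (s k ^ 2)⁻¹ * y k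

section

variable {M : ℕ} (w θ : Fin M → ℂ) {y s : ℕ → ℂ}

theorem singular_subset (y s : ℕ → ℂ) (K : ℕ) :
    (singular w y s K : Set ℂ) ⊆ inner w y ∪ outer y s := by
  intro x hx
  simp only [singular, Finset.coe_union, Finset.coe_image, Set.mem_union, Set.mem_image] at hx
  rcases hx with (⟨j, -, rfl⟩ | ⟨j, -, rfl⟩) | ⟨j, -, rfl⟩
  · exact Or.inl (Or.inl ⟨j, rfl⟩)
  · exact Or.inl (Or.inr ⟨j, rfl⟩)
  · exact Or.inr ⟨j, rfl⟩

theorem sub_ne_zero_of_notMem_singular {K : ℕ} {z : ℂ} (hz : z ∉ singular w y s K) {j : ℕ}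
    (hj : j < K) : y j - z ≠ 0 := by
  intro h
  refine hz ?_
  rw [← sub_eq_zero.1 h]
  simp only [singular, Finset.mem_union, Finset.mem_image, Finset.mem_range]
  exact Or.inl (Or.inl ⟨j, hj, rfl⟩)

theorem sub_row_ne_zero_of_notMem_singular {K : ℕ} {z : ℂ} (hz : z ∉ singular w y s K)
    (i : Fin M) : z - w i ≠ 0 := by
  intro h
  refine hz ?_
  rw [sub_eq_zero.1 h]
  simp only [singular, Finset.mem_union, Finset.mem_image]
  exact Or.inl (Or.inr ⟨i, Finset.mem_univ i, rfl⟩)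

theorem sub_sq_mul_eq (hs : ∀ j, s j ≠ 0) (j : ℕ) (z : ℂ) :
    y j - s j ^ 2 * z = -s j ^ 2 * (z - (s j ^ 2)⁻¹ * y j) := by
  have := hs j
  field_simp
  ring

theorem sub_sq_mul_ne_zero (hs : ∀ j, s j ≠ 0) {j : ℕ} {z : ℂ} (hz : (s j ^ 2)⁻¹ * y j - z ≠ 0) :
    y j - s j ^ 2 * z ≠ 0 := by
  rw [sub_sq_mul_eq hs j z]
  exact mul_ne_zero (neg_ne_zero.2 (pow_ne_zero 2 (hs j))) fun h => hz (by linear_combination -h)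

theorem sub_sq_mul_ne_zero_of_notMem_singular (hs : ∀ j, s j ≠ 0) {K : ℕ} {z : ℂ}
    (hz : z ∉ singular w y s K) {j : ℕ} (hj : j < K) : y j - s j ^ 2 * z ≠ 0 := by
  refine sub_sq_mul_ne_zero hs fun h => hz ?_
  rw [← sub_eq_zero.1 h]
  simp only [singular, Finset.mem_union, Finset.mem_image, Finset.mem_range]
  exact Or.inr ⟨j, hj, rfl⟩

theorem dec_blaschke {S : Set ℂ} (hs : ∀ j, s j ≠ 0) (hS : outer y s ⊆ S) (j : ℕ) :
    Dec S (outer y s) 0 fun z => s j ^ 2 * (y j - z) / (y j - s j ^ 2 * z) := by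
  -- No exceptional point is needed: division by zero makes both expressions vanish at the pole.
  refine (Dec.sub_mul_inv_sub hS (y j) ⟨j, rfl⟩).congr (F := ∅) (by simp) fun z _ => ?_
  have := hs j
  rw [sub_sq_mul_eq hs j z, div_eq_mul_inv, mul_inv]
  field_simp
  ring

theorem dec_blaschke_inv (w : Fin M → ℂ) {S : Set ℂ} (hs : ∀ j, s j ≠ 0) (hS : inner w y ⊆ S)
    (j : ℕ) : Dec S (inner w y) 0 fun z => (y j - s j ^ 2 * z) / (s j ^ 2 * (y j - z)) := by
  refine (Dec.sub_mul_inv_sub hS ((s j ^ 2)⁻¹ * y j) (p := y j) (Or.inl ⟨j, rfl⟩)).congr (F := ∅)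
    (by simp) fun z _ => ?_
  have := hs j
  rw [sub_sq_mul_eq hs j z, div_eq_mul_inv, mul_inv, ← neg_sub z (y j), inv_neg]
  field_simp

theorem dec_column_pole (S : Set ℂ) (hs : ∀ j, s j ≠ 0) (c : ℂ) (j : ℕ) :
    Dec S (outer y s) 1 fun z => c / (y j - s j ^ 2 * z) := by
  refine ((Dec.inv_sub (I := outer y s) S (p := (s j ^ 2)⁻¹ * y j) ⟨j, rfl⟩).const_mul (c / (-s j ^ 2))).congr
    (F := ∅) (by simp) fun z _ => ?_
  rw [sub_sq_mul_eq hs j z, div_mul_eq_div_div, div_eq_mul_inv _ (z - _)]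

theorem dec_inv_sub_left (S : Set ℂ) {I : Set ℂ} {p : ℂ} (hp : p ∈ I) :
    Dec S I 1 fun z => (p - z)⁻¹ := by
  refine ((Dec.inv_sub S hp).const_mul (-1)).congr (F := ∅) (by simp) fun z _ => ?_
  rw [← neg_sub z p, inv_neg, neg_one_mul]

theorem dec_rowFactor {S : Set ℂ} (hS : inner w y ⊆ S) (A : Finset (Fin M)) :
    Dec S (inner w y) 0 fun z => rowFactor A z w θ :=
  Dec.prod A fun i _ => by
    simpa only [div_eq_mul_inv] using Dec.sub_mul_inv_sub hS _ (Or.inr ⟨i, rfl⟩)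

theorem dec_phi (w : Fin M → ℂ) {S : Set ℂ} (hs : ∀ j, s j ≠ 0) (hS : inner w y ⊆ S) (k : ℕ) :
    Dec S (inner w y) 1 fun z => phi k z y s := by
  have h0 : y k ∈ inner w y := Or.inl ⟨k, rfl⟩
  have h1 := dec_inv_sub_left S h0
  have h2 := Dec.prod (F := fun j z => (y j - s j ^ 2 * z) / (s j ^ 2 * (y j - z)))
    (Finset.range k) fun j _ => dec_blaschke_inv w hs hS j
  have h3 := h1.mul h2
  simp only [phi]
  exact h3

theorem dec_psi {S : Set ℂ} (hs : ∀ j, s j ≠ 0) (hS : outer y s ⊆ S) (l : ℕ) :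
    Dec S (outer y s) 1 fun z => psi l z y s := by
  have h1 := dec_column_pole (y := y) S hs (y l * (s l ^ 2 - 1)) l
  have h2 := Dec.prod (F := fun j z => s j ^ 2 * (y j - z) / (y j - s j ^ 2 * z))
    (Finset.range l) fun j _ => dec_blaschke hs hS j
  have h3 := h1.mul h2
  simp only [psi]
  exact h3

theorem blaschke_mul_inv (w : Fin M → ℂ) (hs : ∀ j, s j ≠ 0) {K : ℕ} {z : ℂ}
    (hz : z ∉ singular w y s K) {j : ℕ} (hj : j < K) :
    s j ^ 2 * (y j - z) / (y j - s j ^ 2 * z) * ((y j - s j ^ 2 * z) / (s j ^ 2 * (y j - z))) = 1 := by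
  have h1 := sub_ne_zero_of_notMem_singular w hz hj
  have h2 := sub_sq_mul_ne_zero_of_notMem_singular w hs hz hj
  have h3 := hs j
  generalize y j - z = a at *
  generalize y j - s j ^ 2 * z = b at *
  field_simp

theorem prod_blaschke_mul_inv (w : Fin M → ℂ) (hs : ∀ j, s j ≠ 0) {K : ℕ} {z : ℂ}
    (hz : z ∉ singular w y s K) {l : ℕ} (hl : l ≤ K) :
    (∏ j ∈ Finset.range l, s j ^ 2 * (y j - z) / (y j - s j ^ 2 * z)) *
      ∏ j ∈ Finset.range l, (y j - s j ^ 2 * z) / (s j ^ 2 * (y j - z)) = 1 := by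
  rw [← Finset.prod_mul_distrib]
  exact Finset.prod_eq_one fun j hj =>
    blaschke_mul_inv w hs hz ((Finset.mem_range.1 hj).trans_le hl)

/-- For `k ≤ l` the common factors of `psi l` and `phi k` cancel. -/
theorem psi_mul_phi_of_le (w : Fin M → ℂ) (hs : ∀ j, s j ≠ 0) {k d : ℕ} {z : ℂ}
    (hz : z ∉ singular w y s (k + d + 1)) :
    psi (k + d) z y s * phi k z y s =
      y (k + d) * (s (k + d) ^ 2 - 1) / (y (k + d) - s (k + d) ^ 2 * z) * (y k - z)⁻¹ *
        ∏ j ∈ Finset.range d,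
          s (k + j) ^ 2 * (y (k + j) - z) / (y (k + j) - s (k + j) ^ 2 * z) := by
  have h := prod_blaschke_mul_inv w hs hz (show k ≤ k + d + 1 by omega)
  rw [psi, phi, Finset.prod_range_add]
  linear_combination (y (k + d) * (s (k + d) ^ 2 - 1) / (y (k + d) - s (k + d) ^ 2 * z) *
    (y k - z)⁻¹ * ∏ j ∈ Finset.range d,
          s (k + j) ^ 2 * (y (k + j) - z) / (y (k + j) - s (k + j) ^ 2 * z)) * h

/-- The numerators of `phi k` cancel every outside pole of `psi l`, including the one at index `l`.
The factors `(y l - z)⁻¹` and `(y k - z)⁻¹` remain and give quadratic decay. -/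
theorem dec_psi_mul_phi_of_lt (w : Fin M → ℂ) (hs : ∀ j, s j ≠ 0) {l k : ℕ} (hlk : l < k) :
    Dec (inner w y ∪ outer y s) (inner w y) 2 fun z => psi l z y s * phi k z y s := by
  obtain ⟨d, rfl⟩ := Nat.exists_eq_add_of_lt hlk
  have hS : inner w y ⊆ inner w y ∪ outer y s := Set.subset_union_left
  refine ((((dec_inv_sub_left _ (Or.inl ⟨l, rfl⟩)).const_mul
      (y l * (s l ^ 2 - 1) / s l ^ 2)).mul
    (dec_inv_sub_left _ (Or.inl ⟨l + d + 1, rfl⟩))).mul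
    (Dec.prod (Finset.range d) fun j _ => dec_blaschke_inv w hs hS (l + 1 + j))).congr
    (singular_subset w y s (l + d + 2)) fun z hz => ?_
  have h := prod_blaschke_mul_inv w hs hz (show l ≤ l + d + 2 by omega)
  have h1 := sub_ne_zero_of_notMem_singular w hz (show l < l + d + 2 by omega)
  have h2 := sub_sq_mul_ne_zero_of_notMem_singular w hs hz (show l < l + d + 2 by omega)
  have h3 := hs l
  have e : Finset.range (l + d + 1) = Finset.range (l + 1 + d) := by congr 1; omega
  rw [psi, phi, e, Finset.prod_range_add, Finset.prod_range_succ (fun j =>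
    (y j - s j ^ 2 * z) / (s j ^ 2 * (y j - z)))]
  have h4 : y l * (s l ^ 2 - 1) / (y l - s l ^ 2 * z) *
      ((y l - s l ^ 2 * z) / (s l ^ 2 * (y l - z))) =
      y l * (s l ^ 2 - 1) / s l ^ 2 * (y l - z)⁻¹ := by
    generalize y l - z = a at *
    generalize y l - s l ^ 2 * z = b at *
    field_simp
  rw [← h4]
  linear_combination (-(y l * (s l ^ 2 - 1) / (y l - s l ^ 2 * z) *
      ((y l - s l ^ 2 * z) / (s l ^ 2 * (y l - z))) * (y (l + d + 1) - z)⁻¹ *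
      ∏ j ∈ Finset.range d, (y (l + 1 + j) - s (l + 1 + j) ^ 2 * z) /
        (s (l + 1 + j) ^ 2 * (y (l + 1 + j) - z)))) * h

/-- The zeros of `psi l` cancel every inside pole of `phi k`, including `(y k - z)⁻¹`, so only
outside poles remain. -/
theorem dec_psi_mul_phi_of_gt (w : Fin M → ℂ) (hs : ∀ j, s j ≠ 0) {l k : ℕ} (hkl : k < l) :
    Dec (inner w y ∪ outer y s) (outer y s) 1 fun z => psi l z y s * phi k z y s := by
  obtain ⟨d, rfl⟩ := Nat.exists_eq_add_of_lt hkl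
  have hS : outer y s ⊆ inner w y ∪ outer y s := Set.subset_union_right
  refine (((dec_column_pole _ hs (y (k + d + 1) * (s (k + d + 1) ^ 2 - 1)) (k + d + 1)).mul
    (dec_column_pole _ hs (s k ^ 2) k)).mul
    (Dec.prod (Finset.range d) fun j _ => dec_blaschke hs hS (k + (j + 1)))).congr
    (singular_subset w y s (k + (d + 1) + 1)) (fun z hz => ?_) |>.mono subset_rfl one_le_two
  have h1 := sub_ne_zero_of_notMem_singular w hz (show k < k + (d + 1) + 1 by omega)
  rw [add_assoc k d 1, psi_mul_phi_of_le w hs hz, Finset.prod_range_succ', add_zero]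
  generalize (∏ j ∈ Finset.range d, s (k + (j + 1)) ^ 2 * (y (k + (j + 1)) - z) /
    (y (k + (j + 1)) - s (k + (j + 1)) ^ 2 * z)) = Q
  generalize y (k + (d + 1)) * (s (k + (d + 1)) ^ 2 - 1) /
    (y (k + (d + 1)) - s (k + (d + 1)) ^ 2 * z) = R
  have : (y k - z)⁻¹ * (s k ^ 2 * (y k - z) / (y k - s k ^ 2 * z)) =
      s k ^ 2 / (y k - s k ^ 2 * z) := by
    generalize y k - s k ^ 2 * z = b
    field_simp
  linear_combination (-(R * Q)) * this

variable {J : (ℂ → ℂ) → ℂ}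

theorem integral_psi_mul_phi (hJ : IsResidueFunctional (inner w y) (outer y s) J)
    (hs : ∀ j, s j ≠ 0) (l k : ℕ) :
    J (fun z => psi l z y s * phi k z y s) = if l = k then 1 else 0 := by
  rcases lt_trichotomy l k with h | rfl | h
  · rw [if_neg h.ne, hJ.eq_zero_of_dec_inside (dec_psi_mul_phi_of_lt w hs h)]
  · have hy : y l ∈ inner w y := Or.inl ⟨l, rfl⟩
    have ho : (s l ^ 2)⁻¹ * y l ∈ outer y s := ⟨l, rfl⟩
    have h3 := hs l
    -- On the diagonal everything cancels except one inside and one outside simple pole; the former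
    -- contributes 1, the latter 0.
    have hfg : ∀ z ∉ singular w y s (l + 0 + 1), psi l z y s * phi l z y s =
        (z - y l)⁻¹ + -1 * (z - (s l ^ 2)⁻¹ * y l)⁻¹ := by
      intro z hz
      have h1 := sub_ne_zero_of_notMem_singular w hz (show l < l + 0 + 1 by omega)
      have h2 := sub_sq_mul_ne_zero_of_notMem_singular w hs hz (show l < l + 0 + 1 by omega)
      have h4 := psi_mul_phi_of_le (k := l) (d := 0) w hs hz
      simp only [add_zero, Finset.range_zero, Finset.prod_empty, mul_one] at h4
      have h5 : z - (s l ^ 2)⁻¹ * y l = -(s l ^ 2)⁻¹ * (y l - s l ^ 2 * z) := by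
        rw [mul_sub, ← mul_assoc, neg_mul, neg_mul, inv_mul_cancel₀ (pow_ne_zero 2 h3)]
        ring
      have h6 : y l * (s l ^ 2 - 1) = (y l - s l ^ 2 * z) * -1 + (y l - z) * s l ^ 2 := by ring
      rw [h4, h5, h6, ← neg_sub (y l) z]
      generalize y l - z = a at *
      generalize y l - s l ^ 2 * z = b at *
      field_simp
    have fy := FinDiff.inv_sub (S := inner w y ∪ outer y s) (Or.inl hy)
    have fo := FinDiff.inv_sub (S := inner w y ∪ outer y s) (Or.inr ho)
    have e1 := hJ.congr _ _ _ (singular_subset w y s (l + 0 + 1)) hfg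
    have e2 := hJ.add _ _ fy ((FinDiff.const _ (-1)).mul fo)
    rw [if_pos rfl, e1, e2, hJ.const_mul _ _ fo, hJ.inv_inside _ hy, hJ.inv_outside _ ho]
    simp
  · rw [if_neg h.ne', hJ.eq_zero_of_dec_outside (dec_psi_mul_phi_of_gt w hs h)]

end

/-! ### The row recursion for the integrals -/

theorem horizVec_apply {N : ℕ} (x : ℂ) (y : ℕ → ℂ) (r : ℂ) (s : ℕ → ℂ) (v : ℕ → Fin N → ℂ)
    (l : ℕ) (j : Fin N) : horizVec x y r s v l j = horizVec x y r s (fun l => v l j) l := by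
  induction l with
  | zero => rfl
  | succ l ih => simp [horizVec, ih]

theorem rowEvolve_apply {N : ℕ} (x : ℂ) (y : ℕ → ℂ) (r : ℂ) (s : ℕ → ℂ) (v : ℕ → Fin N → ℂ)
    (l : ℕ) (j : Fin N) : rowEvolve x y r s v l j = rowEvolve x y r s (fun l => v l j) l := by
  simp [rowEvolve, horizVec_apply]

theorem horizVec_mul_const (x : ℂ) (y : ℕ → ℂ) (r : ℂ) (s : ℕ → ℂ) (v : ℕ → ℂ) (c : ℂ) (l : ℕ) :
    horizVec x y r s (fun l => v l * c) l = horizVec x y r s v l * c := by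
  induction l with
  | zero => simp [horizVec]
  | succ l ih =>
    simp only [horizVec, ih, smul_eq_mul]
    ring

theorem rowEvolve_mul_const (x : ℂ) (y : ℕ → ℂ) (r : ℂ) (s : ℕ → ℂ) (v : ℕ → ℂ) (c : ℂ) (l : ℕ) :
    rowEvolve x y r s (fun l => v l * c) l = rowEvolve x y r s v l * c := by
  simp only [rowEvolve, horizVec_mul_const, smul_eq_mul]
  ring

namespace IsResidueFunctional

variable {I O : Set ℂ} {J : (ℂ → ℂ) → ℂ}

theorem linear_comb (hJ : IsResidueFunctional I O J) (a b : ℂ) {f g : ℂ → ℂ}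
    (hf : FinDiff (I ∪ O) f) (hg : FinDiff (I ∪ O) g) :
    FinDiff (I ∪ O) (fun z => a * f z + b * g z) ∧
      J (fun z => a * f z + b * g z) = a * J f + b * J g := by
  have h1 := (FinDiff.const (I ∪ O) a).mul hf
  have h2 := (FinDiff.const (I ∪ O) b).mul hg
  exact ⟨h1.add h2, by rw [hJ.add _ _ h1 h2, hJ.const_mul _ _ hf, hJ.const_mul _ _ hg]⟩

theorem horizVec (hJ : IsResidueFunctional I O J) (x : ℂ) (y : ℕ → ℂ) (r : ℂ) (s : ℕ → ℂ)
    {f : ℕ → ℂ → ℂ} (hf : ∀ l, FinDiff (I ∪ O) (f l)) (l : ℕ) :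
    FinDiff (I ∪ O) (fun z => FreeFermion.horizVec x y r s (fun l => f l z) l) ∧
      J (fun z => FreeFermion.horizVec x y r s (fun l => f l z) l) =
        FreeFermion.horizVec x y r s (fun l => J (f l)) l := by
  induction l with
  | zero =>
    have h := hJ.const_mul 0 (fun _ => 0) (FinDiff.const _ 0)
    simp only [zero_mul] at h
    exact ⟨FinDiff.const _ 0, h⟩
  | succ l ih =>
    have h := hJ.linear_comb (vertexWeight x (y l) r (s l) false true false true)
      (vertexWeight x (y l) r (s l) true false false true) ih.1 (hf l)
    rw [ih.2] at h
    exact h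

theorem rowEvolve (hJ : IsResidueFunctional I O J) (x : ℂ) (y : ℕ → ℂ) (r : ℂ) (s : ℕ → ℂ)
    {f : ℕ → ℂ → ℂ} (hf : ∀ l, FinDiff (I ∪ O) (f l)) (l : ℕ) :
    FinDiff (I ∪ O) (fun z => FreeFermion.rowEvolve x y r s (fun l => f l z) l) ∧
      J (fun z => FreeFermion.rowEvolve x y r s (fun l => f l z) l) =
        FreeFermion.rowEvolve x y r s (fun l => J (f l)) l := by
  have ih := hJ.horizVec x y r s hf l
  have h := hJ.linear_comb (vertexWeight x (y l) r (s l) false true true false)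
      (vertexWeight x (y l) r (s l) true false true false) ih.1 (hf l)
  rw [ih.2] at h
  exact h

theorem sum (hJ : IsResidueFunctional I O J) (c : ℕ → ℂ) {f : ℕ → ℂ → ℂ}
    (hf : ∀ p, FinDiff (I ∪ O) (f p)) (n : ℕ) :
    FinDiff (I ∪ O) (fun z => ∑ p ∈ Finset.range n, c p * f p z) ∧
      J (fun z => ∑ p ∈ Finset.range n, c p * f p z) = ∑ p ∈ Finset.range n, c p * J (f p) := by
  induction n with
  | zero =>
    have h := hJ.const_mul 0 (fun _ => 0) (FinDiff.const _ 0)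
    simp only [zero_mul] at h
    simpa using ⟨FinDiff.const _ 0, h⟩
  | succ n ih =>
    have h := hJ.linear_comb 1 (c n) ih.1 (hf n)
    simp only [one_mul] at h
    simp only [Finset.sum_range_succ]
    rwa [ih.2] at h

end IsResidueFunctional

/-- The column step for `horizVec_psi`, with `q = s²`, `W = w (r⁻² - 1)`, and `P`, `Q` the products
of column factors at `z` and at `w`. -/
theorem horizVec_step {y q z w : ℂ} (P Q W : ℂ) (hD : y - q * w ≠ 0) (hDz : y - q * z ≠ 0)
    (hz : z - w ≠ 0) :
    q * (y - w) / (y - q * w) * (W * (P - Q) / (z - w)) +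
        W * q / (y - q * w) * (y * (q - 1) / (y - q * z) * P) =
      W * (P * (q * (y - z) / (y - q * z)) - Q * (q * (y - w) / (y - q * w))) / (z - w) := by
  field_simp
  ring

theorem rowEvolve_step {y q z w : ℂ} (P Q r : ℂ) (hD : y - q * w ≠ 0) (hDz : y - q * z ≠ 0)
    (hz : z - w ≠ 0) :
    y * (1 - q) / (y - q * w) * (w * (r - 1) * (P - Q) / (z - w)) +
        (y - q * (r * w)) / (y - q * w) * (y * (q - 1) / (y - q * z) * P) =
      y * (q - 1) / (y - q * z) * P * ((z - r * w) / (z - w)) +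
        w * (r - 1) * (y * (q - 1) / (y - q * w) * Q) * (z - w)⁻¹ := by
  field_simp
  ring

section

variable {y s : ℕ → ℂ} {x z : ℂ}

theorem div_inv_sq_mul_sub (hs : ∀ j, s j ≠ 0) (a : ℂ) (j : ℕ) :
    a / ((s j ^ 2)⁻¹ * y j - x) = s j ^ 2 * a / (y j - s j ^ 2 * x) := by
  have h : y j - s j ^ 2 * x = s j ^ 2 * ((s j ^ 2)⁻¹ * y j - x) := by
    rw [mul_sub, mul_inv_cancel_left₀ (pow_ne_zero 2 (hs j))]
  rw [h, mul_div_mul_left _ _ (pow_ne_zero 2 (hs j))]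

/-- The horizontal amplitude is a divided difference between `z` and `x` of the product of the
column factors; the sum over the column of entry telescopes. -/
theorem horizVec_psi (hs : ∀ j, s j ≠ 0) (hx : ∀ j, (s j ^ 2)⁻¹ * y j - x ≠ 0) (r : ℂ)
    (hzx : z - x ≠ 0) (l : ℕ) (hz : ∀ j < l, y j - s j ^ 2 * z ≠ 0) :
    horizVec x y r s (fun l => psi l z y s) l = x * ((r ^ 2)⁻¹ - 1) *
      ((∏ j ∈ Finset.range l, s j ^ 2 * (y j - z) / (y j - s j ^ 2 * z)) -
        ∏ j ∈ Finset.range l, s j ^ 2 * (y j - x) / (y j - s j ^ 2 * x)) / (z - x) := by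
  induction l with
  | zero => simp [horizVec]
  | succ l ih =>
    rw [horizVec, ih fun j hj => hz j (by omega), Finset.prod_range_succ, Finset.prod_range_succ]
    simp only [vertexWeight, smul_eq_mul, div_inv_sq_mul_sub hs, psi]
    rw [← horizVec_step _ _ _ (sub_sq_mul_ne_zero hs (hx l)) (hz l (by omega)) hzx,
      mul_comm (s l ^ 2) (x * _)]

/-- `psi` is multiplied by the row factor, up to a defect caused by the left boundary. As a function
of `z` the defect is a constant times `(z - x)⁻¹`, which is what lets the integral remove it. -/
theorem rowEvolve_psi (hs : ∀ j, s j ≠ 0) (hx : ∀ j, (s j ^ 2)⁻¹ * y j - x ≠ 0) (r : ℂ)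
    (hzx : z - x ≠ 0) (l : ℕ) (hz : ∀ j < l + 1, y j - s j ^ 2 * z ≠ 0) :
    rowEvolve x y r s (fun l => psi l z y s) l =
      psi l z y s * ((z - (r ^ 2)⁻¹ * x) / (z - x)) +
        x * ((r ^ 2)⁻¹ - 1) * psi l x y s * (z - x)⁻¹ := by
  have h1 : s l ^ 2 * (y l * ((s l ^ 2)⁻¹ - 1)) = y l * (1 - s l ^ 2) := by
    rw [mul_left_comm, mul_sub, mul_inv_cancel₀ (pow_ne_zero 2 (hs l)), mul_one]
  have h2 : s l ^ 2 * ((s l ^ 2)⁻¹ * y l - (r ^ 2)⁻¹ * x) = y l - s l ^ 2 * ((r ^ 2)⁻¹ * x) := by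
    rw [mul_sub, mul_inv_cancel_left₀ (pow_ne_zero 2 (hs l))]
  rw [rowEvolve, horizVec_psi hs hx r hzx l fun j hj => hz j (by omega)]
  simp only [vertexWeight, smul_eq_mul, div_inv_sq_mul_sub hs, psi, h1, h2]
  exact rowEvolve_step _ _ _ (sub_sq_mul_ne_zero hs (hx l)) (hz l (by omega)) hzx

end

/-! ### One-particle amplitudes as integrals -/

section

variable {M : ℕ} {w θ : Fin M → ℂ} {y s : ℕ → ℂ} {J : (ℂ → ℂ) → ℂ}

/-- The one particle amplitude for the rows in `A`. -/
def amplitude (J : (ℂ → ℂ) → ℂ) (A : Finset (Fin M)) (w θ : Fin M → ℂ) (y s : ℕ → ℂ) (l k : ℕ) :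
    ℂ :=
  J fun z => psi l z y s * (phi k z y s * rowFactor A z w θ)

theorem amplitude_empty (hJ : IsResidueFunctional (inner w y) (outer y s) J)
    (hs : ∀ j, s j ≠ 0) (l k : ℕ) :
    amplitude J ∅ w θ y s l k = if l = k then 1 else 0 := by
  rw [← integral_psi_mul_phi w hJ hs, amplitude]
  simp [rowFactor]

theorem dec_phi_mul_rowFactor (hs : ∀ j, s j ≠ 0) (A : Finset (Fin M)) (k : ℕ) :
    Dec (inner w y ∪ outer y s) (inner w y) 1 fun z => phi k z y s * rowFactor A z w θ := by
  have h1 := dec_phi (S := inner w y ∪ outer y s) w hs Set.subset_union_left k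
  have h2 := dec_rowFactor (S := inner w y ∪ outer y s) w θ Set.subset_union_left A
  have h3 := h1.mul h2
  exact h3

theorem finDiff_psi (w : Fin M → ℂ) (hs : ∀ j, s j ≠ 0) (l : ℕ) :
    FinDiff (inner w y ∪ outer y s) fun z => psi l z y s :=
  (dec_psi hs Set.subset_union_right l).finDiff Set.subset_union_right

theorem amplitude_insert (hJ : IsResidueFunctional (inner w y) (outer y s) J)
    (hs : ∀ j, s j ≠ 0) (hw : ∀ j i, (s i ^ 2)⁻¹ * y i - w j ≠ 0) {A : Finset (Fin M)} {j : Fin M}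
    (hj : j ∉ A) (l k : ℕ) :
    amplitude J (insert j A) w θ y s l k =
      rowEvolve (w j) y (θ j) s (fun l => amplitude J A w θ y s l k) l := by
  have hX := dec_phi_mul_rowFactor (w := w) (θ := θ) (y := y) hs A k
  have fX := hX.finDiff Set.subset_union_left
  have hR := hJ.rowEvolve (w j) y (θ j) s
    (f := fun l z => psi l z y s * (phi k z y s * rowFactor A z w θ))
    (fun l => (finDiff_psi w hs l).mul fX) l
  have hwj : w j ∈ inner w y := Or.inr ⟨j, rfl⟩
  -- The defect in `rowEvolve_psi` enters multiplied by `phi k` and the old row factors: its poles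
  -- are all inside and its decay order is two, so its integral is zero.
  have hY := (Dec.inv_sub (inner w y ∪ outer y s) hwj).mul hX
  have fY := hY.finDiff Set.subset_union_left
  have hlin := hJ.linear_comb 1 (-(w j * ((θ j ^ 2)⁻¹ - 1) * psi l (w j) y s)) hR.1 fY
  have h0 := hJ.eq_zero_of_dec_inside hY
  have h1 := hlin.2
  rw [h0, mul_zero, add_zero, one_mul, hR.2] at h1
  unfold amplitude
  rw [← h1]
  refine hJ.congr _ _ _ (singular_subset w y s (l + 1)) fun z hz => ?_
  have hzw := sub_row_ne_zero_of_notMem_singular w hz j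
  have hzs := fun i hi => sub_sq_mul_ne_zero_of_notMem_singular w hs hz (j := i) hi
  rw [rowEvolve_mul_const, rowEvolve_psi hs (hw j) (θ j) hzw l hzs, rowFactor,
    Finset.prod_insert hj, ← rowFactor]
  ring

theorem skewG_eq_det_amplitude (hJ : IsResidueFunctional (inner w y) (outer y s) J)
    (hs : ∀ j, s j ≠ 0) (hw : ∀ j i, (s i ^ 2)⁻¹ * y i - w j ≠ 0) {N : ℕ} {lam ν : Fin N → ℕ}
    (hlam : Antitone lam) (hν : Antitone ν) :
    skewG ν lam w y θ s = (Matrix.of fun i j =>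
      amplitude J Finset.univ w θ y s (site ν i) (site lam j)).det := by
  -- `A m` consists of the rows below level `m`, so each level inserts a single new row.
  let A : Fin (M + 1) → Finset (Fin M) := fun m => Finset.univ.filter fun i => i.castSucc < m
  have h := skewG_eq_det hlam hν w y θ s hw
    (fun m l j => amplitude J (A m) w θ y s l (site lam j)) ?_ ?_
  · have hA : A (Fin.last M) = Finset.univ := by
      ext i
      simp [A, Fin.castSucc_lt_last]
    rw [h, hA]
  · have hA : A 0 = ∅ := by
      ext i
      simp [A]
    funext l j
    rw [hA, amplitude_empty hJ hs]
  · intro m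
    have hA : A m.succ = insert m (A m.castSucc) := by
      ext i
      simp only [A, Finset.mem_filter, Finset.mem_univ, true_and, Finset.mem_insert,
        Fin.castSucc_lt_succ_iff, Fin.castSucc_lt_castSucc_iff]
      exact le_iff_eq_or_lt
    have hm : m ∉ A m.castSucc := by simp [A]
    funext l j
    rw [rowEvolve_apply, hA, amplitude_insert hJ hs hw hm]

theorem g_eq_amplitude (hJ : IsResidueFunctional (inner w y) (outer y s) J)
    (hs : ∀ j, s j ≠ 0) (l k : ℕ) :
    g J l k w y θ s = amplitude J Finset.univ w θ y s l k := by
  rcases lt_or_ge l k with hlk | hkl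
  -- The convention that `hTilde` is zero at negative indices matches the vanishing of this
  -- amplitude by decay.
  · have h1 := dec_psi_mul_phi_of_lt (y := y) w hs hlk
    have h2 := dec_rowFactor (S := inner w y ∪ outer y s) w θ Set.subset_union_left Finset.univ
    have h3 := h1.mul h2
    have h4 := hJ.eq_zero_of_dec_inside h3
    rw [g, hTilde, if_neg (by omega), amplitude, ← h4]
    simp only [mul_assoc]
  · obtain ⟨d, rfl⟩ := Nat.exists_eq_add_of_le hkl
    have hd : ((k + d : ℕ) : ℤ) - (k : ℤ) = (d : ℤ) := by push_cast; ring
    rw [g, hTilde, hd, if_pos (by omega), Int.toNat_natCast, amplitude]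
    refine hJ.congr _ _ _ (singular_subset w y s (k + d + 1)) fun z hz => ?_
    rw [← mul_assoc, psi_mul_phi_of_le w hs hz, rowFactor]
    simp only [shift, add_zero]
    rw [div_mul_eq_div_div, div_eq_mul_inv _ (y k - z), mul_comm (s (k + d) ^ 2 - 1)]

end

/-- The weight denominators do not vanish because a point `w j` equal to some `(s i ^ 2)⁻¹ * y i`
would be both inside and outside. -/
theorem IsIntegralAround.isResidueFunctional {M : ℕ} {w : Fin M → ℂ} {y s : ℕ → ℂ}
    {J : (ℂ → ℂ) → ℂ} (hJ : IsIntegralAround w y s J) :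
    IsResidueFunctional (inner w y) (outer y s) J ∧ ∀ j i, (s i ^ 2)⁻¹ * y i - w j ≠ 0 := by
  rcases hJ with ⟨γ, ⟨hγ, hy, hw, ho⟩, rfl⟩ | ⟨hd, rfl⟩
  · constructor
    · refine hγ.isResidueFunctional ?_ ?_
      · rintro p (⟨j, rfl⟩ | ⟨j, rfl⟩)
        exacts [hy j, hw j]
      · rintro p ⟨j, rfl⟩
        exact ho j
    · intro j i h
      have h1 := (hw j).2
      have h2 := (ho i).2
      rw [sub_eq_zero.1 h] at h2
      rw [h1] at h2
      simp at h2
  · refine ⟨formalIntegral_isResidueFunctional hd, fun j i h => ?_⟩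
    refine Set.disjoint_left.1 hd (Or.inr ⟨j, rfl⟩) ⟨i, ?_⟩
    exact sub_eq_zero.1 h

/-! ### Partial fractions and the formula for `nonskewG` -/

theorem exists_partial_fraction_step {k : ℕ} {y o e : ℕ → ℂ}
    (hy : ∀ j < k, y j ≠ y k)
    (he : ∀ z, (∀ j < k, y j - z ≠ 0) →
      ∏ j ∈ Finset.range k, (o j - z) / (y j - z) =
        1 + ∑ p ∈ Finset.range k, e p * (y p - z)⁻¹) :
    ∃ c : ℕ → ℂ, c k = ∏ j ∈ Finset.range k, (o j - y k) / (y j - y k) ∧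
      ∀ z, (∀ j < k + 1, y j - z ≠ 0) →
        (y k - z)⁻¹ * ∏ j ∈ Finset.range k, (o j - z) / (y j - z) =
          ∑ p ∈ Finset.range (k + 1), c p * (y p - z)⁻¹ := by
  -- Splitting `(y k - z)⁻¹ (y p - z)⁻¹` yields the coefficient `e p / (y k - y p)`. The remaining
  -- multiples of `(y k - z)⁻¹` add up to the expansion in `he` evaluated at `y k`.
  refine ⟨fun p => if p = k then ∏ j ∈ Finset.range k, (o j - y k) / (y j - y k)
    else e p * (y k - y p)⁻¹, if_pos rfl, fun z hz => ?_⟩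
  beta_reduce
  rw [Finset.sum_range_succ, if_pos rfl, he z fun j hj => hz j (by omega),
    he (y k) fun j hj => sub_ne_zero.2 (hy j hj), mul_add, add_mul, Finset.mul_sum, Finset.sum_mul,
    mul_one, one_mul, add_comm _ ((y k - z)⁻¹ + _), add_assoc, ← Finset.sum_add_distrib]
  congr 1
  refine Finset.sum_congr rfl fun p hp => ?_
  have hp := Finset.mem_range.1 hp
  rw [if_neg hp.ne]
  have h1 := hz p (by omega)
  have h2 := hz k (by omega)
  have h3 := sub_ne_zero.2 (hy p hp)
  rw [← neg_sub (y p) (y k), inv_neg]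
  have h4 : y k - z = (y p - z) - (y p - y k) := by ring
  rw [h4] at h2 ⊢
  generalize y p - z = a at *
  generalize y p - y k = b at *
  field_simp
  ring

theorem exists_partial_fraction {y : ℕ → ℂ} (o : ℕ → ℂ) (k : ℕ)
    (hy : ∀ i < k, ∀ j < k, i ≠ j → y i ≠ y j) :
    ∃ e : ℕ → ℂ, ∀ z, (∀ j < k, y j - z ≠ 0) →
      ∏ j ∈ Finset.range k, (o j - z) / (y j - z) =
        1 + ∑ p ∈ Finset.range k, e p * (y p - z)⁻¹ := by
  induction k with
  | zero => exact ⟨0, by simp⟩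
  | succ k ih =>
    obtain ⟨e, he⟩ := ih fun i hi j hj => hy i (by omega) j (by omega)
    obtain ⟨c, -, hc⟩ := exists_partial_fraction_step (o := o)
      (fun j hj => hy j (by omega) k (by omega) hj.ne) he
    refine ⟨fun p => (if p < k then e p else 0) + (o k - y k) * c p, fun z hz => ?_⟩
    have h1 := he z fun j hj => hz j (by omega)
    have h2 := hc z hz
    have h3 : ∑ p ∈ Finset.range (k + 1), (if p < k then e p else 0) * (y p - z)⁻¹ =
        ∑ p ∈ Finset.range k, e p * (y p - z)⁻¹ := by
      rw [Finset.sum_range_succ, if_neg (lt_irrefl k), zero_mul, add_zero]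
      exact Finset.sum_congr rfl fun p hp => by rw [if_pos (Finset.mem_range.1 hp)]
    simp only [add_mul, Finset.sum_add_distrib, h3, mul_assoc, ← Finset.mul_sum]
    rw [← h2, ← add_assoc, ← h1, Finset.prod_range_succ]
    have h4 : (o k - z) / (y k - z) = 1 + (o k - y k) * (y k - z)⁻¹ := by
      have := hz k (by omega)
      field_simp
      ring
    rw [h4]
    ring

section

variable {M : ℕ} {w θ : Fin M → ℂ} {y s : ℕ → ℂ} {J : (ℂ → ℂ) → ℂ}

/-- The amplitudes for the first columns are triangular combinations of the `h`. -/
theorem exists_amplitude_eq_sum_h (hJ : IsResidueFunctional (inner w y) (outer y s) J)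
    (hs : ∀ j, s j ≠ 0) {k : ℕ} (hy : ∀ i < k + 1, ∀ j < k + 1, i ≠ j → y i ≠ y j) :
    ∃ c : ℕ → ℂ, c k = ∏ j ∈ Finset.range k, ((s j ^ 2)⁻¹ * y j - y k) / (y j - y k) ∧
      ∀ l, amplitude J Finset.univ w θ y s l k =
        ∑ p ∈ Finset.range (k + 1), c p * h J l p w y θ s := by
  obtain ⟨e, he⟩ := exists_partial_fraction (y := y) (fun j => (s j ^ 2)⁻¹ * y j) k
    fun i hi j hj => hy i (by omega) j (by omega)
  obtain ⟨c, hck, hc⟩ := exists_partial_fraction_step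
    (fun j hj => hy j (by omega) k (by omega) hj.ne) he
  refine ⟨c, hck, fun l => ?_⟩
  have hf : ∀ p, FinDiff (inner w y ∪ outer y s) fun z =>
      psi l z y s / (y p - z) * ∏ j : Fin M, (z - (θ j ^ 2)⁻¹ * w j) / (z - w j) := by
    intro p
    have hp : y p ∈ inner w y := Or.inl ⟨p, rfl⟩
    have h1 := (dec_inv_sub_left (inner w y ∪ outer y s) hp).finDiff Set.subset_union_left
    have h2 := (dec_rowFactor (S := inner w y ∪ outer y s) w θ Set.subset_union_left
      Finset.univ).finDiff Set.subset_union_left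
    have h3 := ((finDiff_psi w hs l).mul h1).mul h2
    simpa only [div_eq_mul_inv, rowFactor] using h3
  have h1 := (hJ.sum c hf (k + 1)).2
  simp only [h]
  rw [← h1, amplitude]
  refine hJ.congr _ _ _ (singular_subset w y s (k + 1)) fun z hz => ?_
  have hzy := fun j hj => sub_ne_zero_of_notMem_singular w hz (j := j) hj
  have hphi : phi k z y s = ∑ p ∈ Finset.range (k + 1), c p * (y p - z)⁻¹ := by
    rw [← hc z hzy, phi]
    congr 1
    refine Finset.prod_congr rfl fun j _ => ?_
    have hj : s j ^ 2 * ((s j ^ 2)⁻¹ * y j - z) = y j - s j ^ 2 * z := by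
      rw [mul_sub, mul_inv_cancel_left₀ (pow_ne_zero 2 (hs j))]
    rw [← mul_div_mul_left _ (y j - z) (pow_ne_zero 2 (hs j)), hj]
  rw [hphi, Finset.sum_mul, Finset.mul_sum]
  refine Finset.sum_congr rfl fun p _ => ?_
  rw [rowFactor, div_eq_mul_inv (psi l z y s)]
  ring

theorem prod_prod_range_eq {N : ℕ} (f : ℕ → ℕ → ℂ) :
    ∏ k : Fin N, ∏ j ∈ Finset.range k, f j k = ∏ i : Fin N, ∏ j ∈ Finset.Ioi i, f i j := by
  have h1 : ∀ k : Fin N, ∏ j ∈ Finset.range k, f j k = ∏ i ∈ Finset.Iio k, f (i : ℕ) k := by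
    intro k
    rw [← Nat.Iio_eq_range, ← Fin.map_valEmbedding_Iio, Finset.prod_map]
    rfl
  simp only [h1]
  exact Finset.prod_comm' (by simp)

/-- The reversal inverts every pair `i < j`, so its sign supplies one factor `-1` for each
denominator. -/
theorem prod_Ioi_mul_sign_revPerm {N : ℕ} (f d : Fin N → Fin N → ℂ) :
    ((Equiv.Perm.sign (Fin.revPerm : Equiv.Perm (Fin N)) : ℤ) : ℂ) *
        ∏ i : Fin N, ∏ j ∈ Finset.Ioi i, f i j / -d i j =
      ∏ i : Fin N, ∏ j ∈ Finset.Ioi i, f i j / d i j := by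
  rw [Equiv.Perm.sign_eq_prod_prod_Ioi]
  push_cast
  rw [← Finset.prod_mul_distrib]
  refine Finset.prod_congr rfl fun i _ => ?_
  rw [← Finset.prod_mul_distrib]
  refine Finset.prod_congr rfl fun j hj => ?_
  have : ¬ Fin.revPerm i < Fin.revPerm j := by
    simpa using (Finset.mem_Ioi.1 hj).le
  rw [if_neg this, div_neg]
  push_cast
  ring

theorem det_amplitude_eq_det_h (hJ : IsResidueFunctional (inner w y) (outer y s) J)
    (hs : ∀ j, s j ≠ 0) {N : ℕ} (hy : ∀ i j : Fin N, i ≠ j → y i ≠ y j) (t : Fin N → ℕ) :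
    (Matrix.of fun i j : Fin N => amplitude J Finset.univ w θ y s (t i) j).det =
      (∏ i : Fin N, ∏ j ∈ Finset.Ioi i, ((s i ^ 2)⁻¹ * y i - y j) / (y i - y j)) *
        (Matrix.of fun i j : Fin N => h J (t i) j w y θ s).det := by
  choose c hck hc using fun k : Fin N => exists_amplitude_eq_sum_h (θ := θ) hJ hs (k := k)
    fun i hi j hj hij => hy ⟨i, by omega⟩ ⟨j, by omega⟩ (by simpa using hij)
  -- The matrix of partial fraction coefficients is upper triangular since `phi k` has poles only at
  -- `y p` with `p ≤ k`; its determinant is the product of the leading coefficients.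
  let C : Matrix (Fin N) (Fin N) ℂ := Matrix.of fun p k => if p ≤ k then c k p else 0
  have hmul : (Matrix.of fun i j : Fin N => amplitude J Finset.univ w θ y s (t i) j) =
      (Matrix.of fun i j : Fin N => h J (t i) j w y θ s) * C := by
    ext i k
    rw [Matrix.mul_apply, Matrix.of_apply, hc k]
    have hsub : (Finset.range (k + 1)) = (Finset.Iic k).map Fin.valEmbedding := by
      rw [Fin.map_valEmbedding_Iic]
      ext a
      simp
    rw [hsub, Finset.sum_map]
    simp only [C, Matrix.of_apply, mul_ite, mul_zero]
    rw [← Finset.sum_filter]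
    refine Finset.sum_congr (by ext p; simp) fun p _ => mul_comm _ _
  have hC : C.det = ∏ i : Fin N, ∏ j ∈ Finset.Ioi i, ((s i ^ 2)⁻¹ * y i - y j) / (y i - y j) := by
    have hup : C.IsUpperTriangular := fun i j hij => if_neg (not_le.2 hij)
    rw [Matrix.det_of_isUpperTriangular hup,
      ← prod_prod_range_eq fun i j => ((s i ^ 2)⁻¹ * y i - y j) / (y i - y j)]
    refine Finset.prod_congr rfl fun k _ => ?_
    rw [← hck k]
    exact if_pos le_rfl
  rw [hmul, Matrix.det_mul, hC, mul_comm]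

theorem nonskewG_eq_det_h (hJ : IsResidueFunctional (inner w y) (outer y s) J)
    (hs : ∀ j, s j ≠ 0) (hw : ∀ j i, (s i ^ 2)⁻¹ * y i - w j ≠ 0) {N : ℕ} {ν : Fin N → ℕ}
    (hν : Antitone ν) (hy : ∀ i j : Fin N, i ≠ j → y i ≠ y j) :
    nonskewG ν w y θ s =
      (∏ i : Fin N, ∏ j ∈ Finset.Ioi i, ((s i ^ 2)⁻¹ * y i - y j) / (y j - y i)) *
        (Matrix.of fun i j : Fin N => h J (site ν i) j w y θ s).det := by
  rw [nonskewG, skewG_eq_det_amplitude hJ hs hw antitone_const hν]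
  -- The sites of the zero signature are `N - 1 - j`, so the columns appear in reversed order.
  have hrev : (Matrix.of fun i j : Fin N =>
      amplitude J Finset.univ w θ y s (site ν i) (site (fun _ : Fin N => 0) j)) =
      (Matrix.of fun i j : Fin N => amplitude J Finset.univ w θ y s (site ν i) j).submatrix id
        Fin.revPerm := by
    ext i j
    simp only [Matrix.of_apply, Matrix.submatrix_apply, id, site, Fin.revPerm_apply, Fin.val_rev]
    congr 1
    omega
  have hsign := prod_Ioi_mul_sign_revPerm
    (fun i j : Fin N => (s i ^ 2)⁻¹ * y i - y j) fun i j => y j - y i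
  simp only [neg_sub] at hsign
  rw [hrev, Matrix.det_permute', det_amplitude_eq_det_h hJ hs hy, ← mul_assoc, hsign]

end

end FreeFermion

end

theorem proposition4p8 (N M : ℕ) (hN : 1 ≤ N) (hM : 1 ≤ M)
    (w θ : Fin M → ℂ) (y s : ℕ → ℂ)
    (hθ : ∀ j, θ j ≠ 0) (hs : ∀ j, s j ≠ 0)
    (J : (ℂ → ℂ) → ℂ) (hJ : FreeFermion.IsIntegralAround w y s J) :
    (∀ ν : Fin N → ℕ, Antitone ν → (∀ i j : Fin N, i ≠ j → y i ≠ y j) →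
      FreeFermion.nonskewG ν w y θ s =
        (∏ i : Fin N, ∏ j ∈ Finset.Ioi i, ((s i ^ 2)⁻¹ * y i - y j) / (y j - y i)) *
          (Matrix.of fun i j : Fin N =>
            FreeFermion.h J (FreeFermion.site ν i) j w y θ s).det) ∧
    (∀ lam ν : Fin N → ℕ, Antitone lam → Antitone ν →
      FreeFermion.skewG ν lam w y θ s =
        (Matrix.of fun i j : Fin N =>
          FreeFermion.g J (FreeFermion.site ν i) (FreeFermion.site lam j) w y θ s).det) := by
  obtain ⟨hR, hw⟩ := hJ.isResidueFunctional
  refine ⟨fun ν hν hy => FreeFermion.nonskewG_eq_det_h hR hs hw hν hy, fun lam ν hlam hν => ?_⟩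
  rw [FreeFermion.skewG_eq_det_amplitude hR hs hw hlam hν]
  simp only [FreeFermion.g_eq_amplitude hR hs]
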